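/- Let $d\ge 2$ be an integer, $0<r<1$ and $q\ge 1$ be real. Let $\mathcal K^{(1)}_{d,r}$ be the class of all compact convex sets $K\subset\mathbb R^d$ of positive volume that are contained in the closed unit ball centred at the origin and satisfy the $r$-rolling condition: every $x\in\partial K$ lies in some closed Euclidean ball of radius $r$ contained in $K$. For $n\ge1$ let $X_1,\dots,X_n$ be independent random points, each uniformly distributed in $K$, and let $\mathbb E_K$ denote expectation under their joint law. A set estimator $\widetilde K_n$ is a map from $(\mathbb R^d)^n$ to the compact subsets of $\mathbb R^d$ such that $\{(x_1,\dots,x_n,y):\ y\in\widetilde K_n(x_1,\dots,x_n)\}$ is a Borel set; write $\widetilde K_n$ also for $\widetilde K_n(X_1,\dots,X_n)$. Let $d_H$ be the Hausdorff distance (equal to $+\infty$ if exactly one of the two sets is empty). (1) Minimax lower bound: there is a constant $c>0$, depending only on $d$, $r$ and $q$, such that for every $n\ge1$ and every set estimator $\widetilde K_n$, $$\sup_{K\in\mathcal K^{(1)}_{d,r}}\mathbb E_K\big[d_H(\widetilde K_n,K)^q\big]\ \ge\ c\left(\frac{\ln n}{n}\right)^{\frac{2q}{d+1}}.$$ (2)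 Consequently the convex hull $\widehat K_n$ of $X_1,\dots,X_n$ is rate-optimal: it is a set estimator, and there is a constant $C>0$, depending only on $d$, $r$ and $q$, such that for every $n\ge2$, $$\sup_{K\in\mathcal K^{(1)}_{d,r}}\mathbb E_K\big[d_H(\widehat K_n,K)^q\big]\ \le\ C\left(\frac{\ln n}{n}\right)^{\frac{2q}{d+1}}.$$ -/

import Mathlib

open MeasureTheory ProbabilityTheory
open scoped ENNReal

noncomputable section

/-- The Euclidean space of dimension `d`. -/
abbrev Euc (d : ℕ) : Type := EuclideanSpace ℝ (Fin d)

/-- The `r`-rolling condition: every boundary point `x` of `K` lies in a closed Euclidean ball of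
radius `r` that is contained in `K`. -/
def RollingCondition {d : ℕ} (r : ℝ) (K : Set (Euc d)) : Prop :=
  ∀ x ∈ frontier K, ∃ a : Euc d, x ∈ Metric.closedBall a r ∧ Metric.closedBall a r ⊆ K

/-- The convex bodies (compact convex sets of positive volume) that are contained in the closed
unit ball centred at the origin and satisfy the `r`-rolling condition. Mathlib's `ConvexBody` is a
nonempty compact convex set, so positivity of the volume is required separately. -/
def rollingBodies (d : ℕ) (r : ℝ) : Set (ConvexBody (Euc d)) :=
  {K | 0 < volume (K : Set (Euc d)) ∧ (K : Set (Euc d)) ⊆ Metric.closedBall 0 1 ∧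
    RollingCondition r (K : Set (Euc d))}

/-- The joint law of `n` independent points, each uniformly distributed in `K`. -/
def uniformSample {d : ℕ} (n : ℕ) (K : ConvexBody (Euc d)) : Measure (Fin n → Euc d) :=
  Measure.pi fun _ => ProbabilityTheory.cond volume (K : Set (Euc d))

/-- `T` is a set estimator based on `n` observations in `ℝ^d`: its values are compact subsets of
`ℝ^d` (possibly empty), and the indicator function of `y ∈ T X` is jointly measurable
in `(X, y)`. -/
def IsSetEstimator {d n : ℕ} (T : (Fin n → Euc d) → Set (Euc d)) : Prop :=
  (∀ X, IsCompact (T X)) ∧ MeasurableSet {p : (Fin n → Euc d) × Euc d | p.2 ∈ T p.1}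

/-- The random polytope: the convex hull of the observations. -/
def randomPolytope (d n : ℕ) (X : Fin n → Euc d) : Set (Euc d) :=
  convexHull ℝ (Set.range X)

/-- The risk `E_K [d_H(T, K) ^ q]`, as an element of `[0, ∞]`. The Hausdorff distance between the
empty set and `K` is `∞`. -/
def risk {d n : ℕ} (q : ℝ) (T : (Fin n → Euc d) → Set (Euc d)) (K : ConvexBody (Euc d)) : ℝ≥0∞ :=
  ∫⁻ X, (Metric.hausdorffEDist (T X) (K : Set (Euc d))) ^ q ∂(uniformSample n K)

/-- The supremum of the risk over the convex bodies in the unit ball with the `r`-rolling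
condition. -/
def maxRisk {d n : ℕ} (r q : ℝ) (T : (Fin n → Euc d) → Set (Euc d)) : ℝ≥0∞ :=
  ⨆ K ∈ rollingBodies d r, risk q T K

/-- The rate `(ln n / n) ^ (2 q / (d + 1))`. -/
def rate (d : ℕ) (q : ℝ) (n : ℕ) : ℝ :=
  (Real.log n / n) ^ (2 * q / ((d : ℝ) + 1))

end

/-! In dimension d = m + 1 a cap of height σ² has uniform mass of order σ^(m+2), so mass `ln n / n`
corresponds to height ρ² = (ln n / n)^(2/(d+1)), the rate before raising to the power q.

Upper bound: the rolling ball at a support point gives every cap of K of height σ² mass at least κ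
σ^(m+2) (`exists_le_cond_cap`). If the hull is farther than 2σ² from K, a slab separates them, and
the cap in some direction of a polynomial-size net contains no observation. With σ = Bρ and B large,
the union bound makes this so unlikely that the trivial distance bound 2 suffices on the exceptional
event.

Lower bound: the unit ball is compared with about ρ^(-m) flattened balls, each missing only a cap of
height τ² of order ρ², with the caps disjoint (`exists_flattened_ball`). Sampling from a flattened
ball is sampling from the unit ball conditioned on the event that the cap is empty. Disjointness
makes these events negatively correlated, and each has probability at least n^(-1/6), so the
averaged likelihood ratio has second moment near 1 and no test works
(`exists_error_ge_of_weakly_dependent`). The test used is whether the estimator hits a small ball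
around the pole of the cap; either error forces a distance of order ρ². That event is a projection
of a Borel set, hence universally measurable. -/

/-! ### Universal measurability of analytic sets and of hitting events -/

/-- Finite measures are inner regular on analytic sets with respect to compact sets. -/
theorem MeasureTheory.AnalyticSet.exists_isCompact_subset_le_measure {α : Type*} [MetricSpace α]
    [MeasurableSpace α] [BorelSpace α] {s : Set α} (hs : AnalyticSet s) (μ : Measure α)
    [IsFiniteMeasure μ] {c : ℝ≥0∞} (hc : c < μ s) : ∃ t ⊆ s, IsCompact t ∧ c ≤ μ t := by
  rw [AnalyticSet] at hs
  rcases hs with rfl | ⟨f, hf, rfl⟩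
  · simp at hc
  -- By continuity from below, one coordinate can be bounded while the image keeps measure above
  -- `c`. The implication makes the choice of `m` total in `S` and `k`, so that it can be iterated.
  have step : ∀ (S : Set (ℕ → ℕ)) (k : ℕ), ∃ m : ℕ, c < μ (f '' S) →
      c < μ (f '' (S ∩ {x | x k ≤ m})) := by
    intro S k
    by_cases h : c < μ (f '' S)
    · have hU : f '' S = ⋃ m : ℕ, f '' (S ∩ {x | x k ≤ m}) := by
        rw [← Set.image_iUnion, ← Set.inter_iUnion]
        congr 1
        ext x
        simp only [Set.mem_inter_iff, Set.mem_iUnion, Set.mem_ofPred_eq, iff_self_and]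
        exact fun _ => ⟨x k, le_rfl⟩
      have hmono : Monotone fun m : ℕ => f '' (S ∩ {x | x k ≤ m}) := fun a b hab =>
        Set.image_mono (Set.inter_subset_inter_right _ fun x hx => le_trans hx hab)
      rw [hU, hmono.measure_iUnion, lt_iSup_iff] at h
      obtain ⟨m, hm⟩ := h
      exact ⟨m, fun _ => hm⟩
    · exact ⟨0, fun h' => absurd h' h⟩
  choose b hb using step
  let S : ℕ → Set (ℕ → ℕ) := fun k =>
    Nat.rec Set.univ (fun k S => S ∩ {x | x k ≤ b S k}) k
  have hS : ∀ k, S (k + 1) = S k ∩ {x | x k ≤ b (S k) k} := fun k => rfl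
  have hcS : ∀ k, c < μ (f '' S k) := by
    intro k
    induction k with
    | zero => simpa [S] using hc
    | succ k ih => rw [hS]; exact hb _ _ ih
  have hanti : Antitone S := antitone_nat_of_succ_le fun k => by
    rw [hS]; exact Set.inter_subset_left
  set B : ℕ → ℕ := fun k => b (S k) k with hB
  have hSB : ∀ i k, i < k → ∀ x ∈ S k, x i ≤ B i := by
    intro i k hik x hx
    have := hanti (Nat.succ_le_of_lt hik) hx
    rw [Nat.succ_eq_add_one, hS] at this
    exact this.2
  set K : Set (ℕ → ℕ) := Set.univ.pi fun k => Set.Iic (B k) with hK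
  have hKc : IsCompact K := isCompact_univ_pi fun k => (Set.finite_Iic _).isCompact
  refine ⟨f '' K, Set.image_subset_range _ _, hKc.image hf, ?_⟩
  have hsub : ⋂ k, closure (f '' S k) ⊆ f '' K := by
    intro y hy
    rw [Set.mem_iInter] at hy
    have hx : ∀ k : ℕ, ∃ x ∈ S k, dist y (f x) < 1 / ((k : ℝ) + 1) := by
      intro k
      obtain ⟨_, ⟨x, hx, rfl⟩, h⟩ := Metric.mem_closure_iff.1 (hy k) (1 / ((k : ℝ) + 1))
        (by positivity)
      exact ⟨x, hx, h⟩
    choose x hxS hxd using hx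
    -- Points of `S k` have only their first `k` coordinates bounded by `B`. Truncation puts them
    -- into the compact `K` and does not change the coordinatewise limit.
    obtain ⟨z, hz, φ, hφ, hlim⟩ := hKc.tendsto_subseq (x := fun k i => min (x k i) (B i))
      (fun k i _ => min_le_right (x k i) (B i))
    have hlim' : Filter.Tendsto (fun k => x (φ k)) Filter.atTop (nhds z) := by
      rw [tendsto_pi_nhds] at hlim ⊢
      intro i
      refine (hlim i).congr' ?_
      filter_upwards [Filter.eventually_gt_atTop i] with k hk
      exact min_eq_left (hSB i _ (hk.trans_le (hφ.id_le k)) _ (hxS _))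
    have h1 : Filter.Tendsto (fun k => f (x (φ k))) Filter.atTop (nhds (f z)) :=
      (hf.tendsto z).comp hlim'
    have h2 : Filter.Tendsto (fun k => f (x k)) Filter.atTop (nhds y) := by
      rw [tendsto_iff_dist_tendsto_zero]
      refine squeeze_zero (fun _ => dist_nonneg) (fun k => ?_) tendsto_one_div_add_atTop_nhds_zero_nat
      rw [dist_comm]
      exact (hxd k).le
    exact ⟨z, hz, tendsto_nhds_unique h1 (h2.comp hφ.tendsto_atTop)⟩
  refine le_trans ?_ (measure_mono hsub)
  have hanti' : Antitone fun k => closure (f '' S k) := fun a b hab =>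
    closure_mono (Set.image_mono (hanti hab))
  rw [hanti'.measure_iInter (fun k => isClosed_closure.nullMeasurableSet) ⟨0, measure_ne_top _ _⟩]
  exact le_iInf fun k => (hcS k).le.trans (measure_mono subset_closure)

/-- Analytic sets are universally measurable. -/
theorem MeasureTheory.AnalyticSet.nullMeasurableSet {α : Type*} [MetricSpace α] [MeasurableSpace α]
    [BorelSpace α] {s : Set α} (hs : AnalyticSet s) (μ : Measure α) [IsFiniteMeasure μ] :
    NullMeasurableSet s μ := by
  rcases eq_or_ne (μ s) 0 with h0 | h0
  · exact NullMeasurableSet.of_null h0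
  obtain ⟨u, -, hu, hulim⟩ := exists_seq_strictMono_tendsto' (pos_iff_ne_zero.2 h0)
  have := fun k => hs.exists_isCompact_subset_le_measure μ (hu k).2
  choose t hts htc htm using this
  have hm : MeasurableSet (⋃ k, t k) := MeasurableSet.iUnion fun k => (htc k).measurableSet
  refine hm.nullMeasurableSet.congr (ae_eq_of_subset_of_measure_ge (Set.iUnion_subset hts) ?_
    hm.nullMeasurableSet (measure_ne_top _ _))
  exact le_of_tendsto hulim (Filter.Eventually.of_forall fun k =>
    (htm k).trans (measure_mono (Set.subset_iUnion t k)))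

/-- The event that a set estimator hits a given open set is universally measurable. -/
theorem IsSetEstimator.nullMeasurableSet_inter_nonempty {d n : ℕ}
    {T : (Fin n → Euc d) → Set (Euc d)} (hT : IsSetEstimator T) {U : Set (Euc d)}
    (hU : MeasurableSet U) (μ : Measure (Fin n → Euc d)) [IsFiniteMeasure μ] :
    NullMeasurableSet {X | (T X ∩ U).Nonempty} μ := by
  -- The event is a projection of a Borel set, hence analytic, though it need not be Borel.
  have h : {X | (T X ∩ U).Nonempty} =
      Prod.fst '' ({p : (Fin n → Euc d) × Euc d | p.2 ∈ T p.1} ∩ Prod.snd ⁻¹' U) := by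
    ext X
    constructor
    · rintro ⟨y, hy, hyU⟩
      exact ⟨(X, y), ⟨hy, hyU⟩, rfl⟩
    · rintro ⟨⟨X, y⟩, ⟨hy, hyU⟩, rfl⟩
      exact ⟨y, hy, hyU⟩
  rw [h]
  exact AnalyticSet.nullMeasurableSet
    ((hT.2.inter (measurable_snd hU)).analyticSet_image measurable_fst) μ

/-! ### Volumes of caps of balls -/

theorem exists_orthonormalBasis_apply_zero {m : ℕ} {u : Euc (m + 1)} (hu : ‖u‖ = 1) :
    ∃ b : OrthonormalBasis (Fin (m + 1)) ℝ (Euc (m + 1)), b 0 = u := by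
  obtain ⟨b, hb⟩ := Orthonormal.exists_orthonormalBasis_extension_of_card_eq (𝕜 := ℝ)
    (E := Euc (m + 1)) (ι := Fin (m + 1)) (by simp) (v := fun _ => u) (s := {0})
    ⟨fun _ => hu, fun i j hij => absurd (Subsingleton.elim i j) hij⟩
  exact ⟨b, hb 0 rfl⟩

/-- The volume of a box in the coordinates of an orthonormal basis. -/
theorem volume_setOf_inner_mem_Icc {d : ℕ} (b : OrthonormalBasis (Fin d) ℝ (Euc d)) (a : Euc d)
    (lo hi : Fin d → ℝ) :
    volume {x | ∀ i, inner ℝ (b i) (x - a) ∈ Set.Icc (lo i) (hi i)} =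
      ∏ i, ENNReal.ofReal (hi i - lo i) := by
  have hmp : MeasurePreserving (fun x : Euc d => WithLp.ofLp (b.repr x)) volume volume :=
    (PiLp.volume_preserving_ofLp (Fin d)).comp b.measurePreserving_repr
  have hset : {x | ∀ i, inner ℝ (b i) (x - a) ∈ Set.Icc (lo i) (hi i)} =
      (fun x : Euc d => WithLp.ofLp (b.repr x)) ⁻¹'
        Set.Icc (fun i => lo i + inner ℝ (b i) a) (fun i => hi i + inner ℝ (b i) a) := by
    ext x
    simp only [Set.mem_ofPred_eq, Set.mem_Icc, Set.mem_preimage, Pi.le_def,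
      b.repr_apply_apply, inner_sub_right, ← forall_and]
    exact forall_congr' fun i => by constructor <;> rintro ⟨h1, h2⟩ <;> constructor <;> linarith
  rw [hset, hmp.measure_preimage measurableSet_Icc.nullMeasurableSet, Real.volume_Icc_pi]
  simp

theorem sq_inner_add_sq_inner_le {m : ℕ} (b : OrthonormalBasis (Fin (m + 1)) ℝ (Euc (m + 1)))
    (x : Euc (m + 1)) (i : Fin m) :
    inner ℝ (b 0) x ^ 2 + inner ℝ (b i.succ) x ^ 2 ≤ ‖x‖ ^ 2 := by
  rw [← b.sum_sq_norm_inner_right, Fin.sum_univ_succ]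
  simp only [Real.norm_eq_abs, sq_abs]
  gcongr
  exact Finset.single_le_sum (f := fun i : Fin m => inner ℝ (b i.succ) x ^ 2)
    (fun _ _ => sq_nonneg _) (Finset.mem_univ i)

/-- A cap of height `t` of the unit ball of `ℝ^(m+1)` has volume `O(t ^ ((m + 2) / 2))`. -/
theorem volume_cap_le {m : ℕ} {u : Euc (m + 1)} (hu : ‖u‖ = 1) {t : ℝ} (ht0 : 0 ≤ t)
    (ht1 : t ≤ 1) :
    volume {x | x ∈ Metric.closedBall (0 : Euc (m + 1)) 1 ∧ 1 - t ≤ inner ℝ u x} ≤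
      ENNReal.ofReal (t * (2 * √(2 * t)) ^ m) := by
  obtain ⟨b, rfl⟩ := exists_orthonormalBasis_apply_zero hu
  -- The box contains the cap: transversal coordinates satisfy x_i² ≤ 1 - (1 - t)² ≤ 2t.
  have hbox := volume_setOf_inner_mem_Icc b 0 (Fin.cons (1 - t) fun _ => -√(2 * t))
    (Fin.cons 1 fun _ => √(2 * t))
  rw [Fin.prod_univ_succ] at hbox
  simp only [Fin.cons_zero, Fin.cons_succ, Finset.prod_const, Finset.card_univ,
    Fintype.card_fin] at hbox
  rw [ENNReal.ofReal_mul ht0, ENNReal.ofReal_pow (by positivity)]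
  rw [show 1 - (1 - t) = t by ring, show √(2 * t) - -√(2 * t) = 2 * √(2 * t) by ring] at hbox
  rw [← hbox]
  refine measure_mono ?_
  rintro x ⟨hx, hxt⟩
  rw [mem_closedBall_zero_iff] at hx
  have hx2 : ‖x‖ ^ 2 ≤ 1 := pow_le_one₀ (norm_nonneg _) hx
  intro i
  rw [sub_zero]
  refine Fin.cases ?_ (fun i => ?_) i
  · refine ⟨hxt, ?_⟩
    have := real_inner_le_norm (b 0) x
    rw [hu, one_mul] at this
    exact this.trans hx
  · have := sq_inner_add_sq_inner_le b x i
    have h : inner ℝ (b i.succ) x ^ 2 ≤ 2 * t := by nlinarith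
    exact abs_le.1 (Real.abs_le_sqrt h)

/-- A cap of height `s` of a ball of radius `r` has volume at least of order
`s ^ ((m + 2) / 2)`. -/
theorem le_volume_cap {m : ℕ} {u : Euc (m + 1)} (hu : ‖u‖ = 1) (a : Euc (m + 1)) {r s : ℝ}
    (hs : 0 < s) (hsr : s ≤ r) :
    ENNReal.ofReal (s / 4 * (2 * √(r * s / (4 * (m + 1)))) ^ m) ≤
      volume {x | x ∈ Metric.closedBall a r ∧ r - s < inner ℝ u (x - a)} := by
  obtain ⟨b, rfl⟩ := exists_orthonormalBasis_apply_zero hu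
  set w := √(r * s / (4 * (m + 1))) with hw
  have hr : 0 < r := hs.trans_le hsr
  have hw2 : w ^ 2 * (m + 1) = r * s / 4 := by
    rw [hw, Real.sq_sqrt (by positivity)]
    field_simp
  -- This box lies inside the cap: (r - s/4)² + m w² ≤ r² - rs/4 + s²/16 ≤ r², since s ≤ r.
  have hbox := volume_setOf_inner_mem_Icc b a (Fin.cons (r - s / 2) fun _ => -w)
    (Fin.cons (r - s / 4) fun _ => w)
  rw [Fin.prod_univ_succ] at hbox
  simp only [Fin.cons_zero, Fin.cons_succ, Finset.prod_const, Finset.card_univ,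
    Fintype.card_fin] at hbox
  rw [ENNReal.ofReal_mul (by positivity), ENNReal.ofReal_pow (by positivity)]
  rw [show r - s / 4 - (r - s / 2) = s / 4 by ring, show w - -w = 2 * w by ring] at hbox
  rw [← hbox]
  refine measure_mono ?_
  intro x hx
  have h0 : r - s / 2 ≤ inner ℝ (b 0) (x - a) ∧ inner ℝ (b 0) (x - a) ≤ r - s / 4 := hx 0
  refine ⟨?_, by linarith [h0.1]⟩
  rw [mem_closedBall_iff_norm]
  refine abs_le_of_sq_le_sq' (a := ‖x - a‖) ?_ hr.le |>.2
  rw [← b.sum_sq_norm_inner_right, Fin.sum_univ_succ]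
  simp only [Real.norm_eq_abs, sq_abs]
  have hsum : ∑ i : Fin m, inner ℝ (b i.succ) (x - a) ^ 2 ≤ ∑ _i : Fin m, w ^ 2 := by
    refine Finset.sum_le_sum fun i _ => ?_
    have : -w ≤ inner ℝ (b i.succ) (x - a) ∧ inner ℝ (b i.succ) (x - a) ≤ w := hx i.succ
    exact sq_le_sq' this.1 this.2
  simp only [Finset.sum_const, Finset.card_univ, Fintype.card_fin, nsmul_eq_mul] at hsum
  nlinarith [sq_nonneg w, h0.1, h0.2]

theorem volume_closedBall_pos_and_lt_top {d : ℕ} {a : Euc d} {r : ℝ} (hr : 0 < r) :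
    0 < volume (Metric.closedBall a r) ∧ volume (Metric.closedBall a r) < ∞ :=
  ⟨Metric.measure_closedBall_pos _ _ hr, (isCompact_closedBall a r).measure_lt_top⟩

/-! ### Mass of caps of rolling bodies, and nets of directions -/

/-- In every direction, a convex body with the rolling condition has a supporting hyperplane that
touches a ball of radius `r` inside of the body. -/
theorem exists_support_ball {d : ℕ} {r : ℝ} {K : ConvexBody (Euc d)}
    (hK : K ∈ rollingBodies d r) {u : Euc d} (hu : ‖u‖ = 1) :
    ∃ h : ℝ, ∃ a : Euc d, Metric.closedBall a r ⊆ K ∧ (∀ y ∈ K, inner ℝ u y ≤ h) ∧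
      h ≤ inner ℝ u a + r := by
  obtain ⟨x, hx, hmax⟩ := K.isCompact.exists_isMaxOn K.nonempty
    (f := fun y => inner ℝ u y) (by fun_prop)
  have hxf : x ∈ frontier (K : Set (Euc d)) := by
    refine ⟨subset_closure hx, fun hxi => ?_⟩
    obtain ⟨ε, hε, hball⟩ := Metric.isOpen_iff.1 isOpen_interior x hxi
    have hmem : x + (ε / 2) • u ∈ (K : Set (Euc d)) := by
      refine interior_subset (hball ?_)
      rw [mem_ball_iff_norm, add_sub_cancel_left, norm_smul, hu, Real.norm_of_nonneg (by positivity)]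
      linarith
    have h1 : inner ℝ u (x + (ε / 2) • u) ≤ inner ℝ u x := hmax hmem
    rw [inner_add_right, inner_smul_right, real_inner_self_eq_norm_sq, hu] at h1
    linarith
  obtain ⟨a, hxa, ha⟩ := hK.2.2 x hxf
  refine ⟨inner ℝ u x, a, ha, fun y hy => hmax hy, ?_⟩
  have h1 := real_inner_le_norm u (x - a)
  rw [mem_closedBall_iff_norm] at hxa
  rw [hu, one_mul, inner_sub_right] at h1
  linarith

theorem isProbabilityMeasure_cond_of_mem_rollingBodies {d : ℕ} {r : ℝ} {K : ConvexBody (Euc d)}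
    (hK : K ∈ rollingBodies d r) : IsProbabilityMeasure (cond volume (K : Set (Euc d))) :=
  cond_isProbabilityMeasure_of_finite hK.1.ne' K.isCompact.measure_lt_top.ne

/-- The uniform distribution gives caps of height `σ ^ 2` a mass of at least the order of
`σ ^ (m + 2)`, uniformly over the convex bodies with the rolling condition. -/
theorem exists_le_cond_cap (m : ℕ) {r : ℝ} (hr : 0 < r) :
    ∃ κ : ℝ, 0 < κ ∧ ∀ K ∈ rollingBodies (m + 1) r, ∀ u : Euc (m + 1), ‖u‖ = 1 →
      ∀ σ : ℝ, 0 < σ → σ ^ 2 ≤ r → ∃ h : ℝ, (∀ y ∈ K, inner ℝ u y ≤ h) ∧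
        ENNReal.ofReal (κ * σ ^ (m + 2)) ≤
          cond volume (K : Set (Euc (m + 1))) {y | h - σ ^ 2 < inner ℝ u y} := by
  set V := volume (Metric.closedBall (0 : Euc (m + 1)) 1) with hV
  obtain ⟨hV0, hV1⟩ := volume_closedBall_pos_and_lt_top (a := (0 : Euc (m + 1))) one_pos
  rw [← hV] at hV0 hV1
  have hVi : V⁻¹ ≠ ∞ := ENNReal.inv_ne_top.2 hV0.ne'
  have hVi0 : 0 < V⁻¹.toReal := ENNReal.toReal_pos (ENNReal.inv_ne_zero.2 hV1.ne) hVi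
  refine ⟨V⁻¹.toReal * (1 / 4 * (2 * √(r / (4 * (m + 1)))) ^ m), by positivity, ?_⟩
  intro K hK u hu σ hσ hσr
  obtain ⟨h, a, hball, hh, hha⟩ := exists_support_ball hK hu
  refine ⟨h, hh, ?_⟩
  rw [cond_apply K.isClosed.measurableSet]
  -- The support level is at most that of the inner ball, so the ball's cap lies in the cap of `K`.
  -- The volume of `K` itself is at most `V`.
  have hle : volume {x | x ∈ Metric.closedBall a r ∧ r - σ ^ 2 < inner ℝ u (x - a)} ≤
      volume ((K : Set (Euc (m + 1))) ∩ {y | h - σ ^ 2 < inner ℝ u y}) := by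
    refine measure_mono ?_
    rintro x ⟨hx, hxs⟩
    refine ⟨hball hx, ?_⟩
    rw [inner_sub_right] at hxs
    show h - σ ^ 2 < inner ℝ u x
    linarith
  refine le_trans ?_ (mul_le_mul' (ENNReal.inv_le_inv.2 (measure_mono hK.2.1))
    ((le_volume_cap hu a (by positivity) hσr).trans hle))
  rw [mul_assoc, ENNReal.ofReal_mul hVi0.le, ENNReal.ofReal_toReal hVi]
  refine le_of_eq ?_
  congr 2
  rw [show r * σ ^ 2 / (4 * ((m : ℝ) + 1)) = r / (4 * (m + 1)) * σ ^ 2 by ring,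
    Real.sqrt_mul (by positivity), Real.sqrt_sq hσ.le]
  ring

/-- Unit vectors can be approximated up to `η` by a set of polynomial size in `1 / η`. -/
theorem exists_finset_unit_net (d : ℕ) : ∃ A : ℝ, 0 < A ∧ ∀ η : ℝ, 0 < η → η ≤ 1 →
    ∃ F : Finset (Euc d), (∀ v ∈ F, ‖v‖ = 1) ∧ (F.card : ℝ) ≤ (A / η) ^ d ∧
      ∀ u : Euc d, ‖u‖ = 1 → ∃ v ∈ F, ‖u - v‖ ≤ η := by
  classical
  refine ⟨4 * √d + 3, by positivity, fun η hη hη1 => ?_⟩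
  set N := ⌈2 * √d / η⌉₊ with hN
  have hNle : 2 * √d / η ≤ N := Nat.le_ceil _
  have hNlt : (N : ℝ) < 2 * √d / η + 1 := Nat.ceil_lt_add_one (by positivity)
  rcases Nat.eq_zero_or_pos N with hN0 | hN0
  · have hd : d = 0 := by
      rw [hN0, Nat.cast_zero] at hNle
      by_contra hd
      have : (0 : ℝ) < d := by exact_mod_cast Nat.pos_of_ne_zero hd
      have : 0 < 2 * √d / η := by positivity
      linarith
    subst hd
    refine ⟨∅, by simp, by simp, fun u hu => ?_⟩
    rw [Subsingleton.elim u 0, norm_zero] at hu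
    exact absurd hu zero_ne_one
  have hN0' : (0 : ℝ) < N := by exact_mod_cast hN0
  let G : Finset (Fin d → ℤ) := Fintype.piFinset fun _ => Finset.Icc (-(N : ℤ)) N
  -- One unit vector is picked from each nonempty cell of a grid of mesh 1/N; cells have diameter at
  -- most √d/N ≤ η.
  let cell : (Fin d → ℤ) → Set (Euc d) := fun k => {u | ‖u‖ = 1 ∧ ∀ i, ⌊N * u i⌋ = k i}
  let pt : (Fin d → ℤ) → Euc d := fun k => if h : (cell k).Nonempty then h.some else 0
  have hpt : ∀ k, (cell k).Nonempty → pt k ∈ cell k := fun k hk => by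
    simp only [pt, dif_pos hk]; exact hk.some_mem
  refine ⟨(G.filter fun k => (cell k).Nonempty).image pt, ?_, ?_, ?_⟩
  · intro v hv
    obtain ⟨k, hk, rfl⟩ := Finset.mem_image.1 hv
    exact (hpt k (Finset.mem_filter.1 hk).2).1
  · have h1 : (((G.filter fun k => (cell k).Nonempty).image pt).card : ℝ) ≤ (2 * N + 1 : ℝ) ^ d := by
      have h2 : ((G.filter fun k => (cell k).Nonempty).image pt).card ≤ (2 * N + 1) ^ d := by
        refine Finset.card_image_le.trans ((Finset.card_filter_le _ _).trans (le_of_eq ?_))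
        simp only [G, Fintype.card_piFinset, Int.card_Icc, Finset.prod_const, Finset.card_univ,
          Fintype.card_fin]
        congr 1
        omega
      exact_mod_cast h2
    refine h1.trans (pow_le_pow_left₀ (by positivity) ?_ d)
    have : 1 ≤ 1 / η := (one_le_div hη).2 hη1
    calc (2 * N + 1 : ℝ) ≤ 2 * (2 * √d / η) + 3 * (1 / η) := by linarith
      _ = (4 * √d + 3) / η := by ring
  · intro u hu
    let k : Fin d → ℤ := fun i => ⌊N * u i⌋
    have huk : u ∈ cell k := ⟨hu, fun i => rfl⟩
    have hui : ∀ i, |u i| ≤ 1 := fun i => by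
      have := PiLp.norm_apply_le u i
      rwa [hu, Real.norm_eq_abs] at this
    have hkG : k ∈ G := by
      refine Fintype.mem_piFinset.2 fun i => Finset.mem_Icc.2 ⟨?_, ?_⟩
      · refine Int.le_floor.2 ?_
        push_cast
        nlinarith [(abs_le.1 (hui i)).1]
      · have : (k i : ℝ) ≤ N := (Int.floor_le _).trans (by nlinarith [(abs_le.1 (hui i)).2])
        exact_mod_cast this
    refine ⟨pt k, Finset.mem_image_of_mem _ (Finset.mem_filter.2 ⟨hkG, u, huk⟩), ?_⟩
    obtain ⟨-, hv⟩ := hpt k ⟨u, huk⟩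
    have hcoord : ∀ i, ‖(u - pt k) i‖ ^ 2 ≤ (1 / N : ℝ) ^ 2 := by
      intro i
      have h1 : ⌊(N : ℝ) * u i⌋ = ⌊(N : ℝ) * pt k i⌋ := (hv i).symm
      have h2 := Int.abs_sub_lt_one_of_floor_eq_floor h1
      rw [← mul_sub, abs_mul, abs_of_pos hN0'] at h2
      have h3 : |u i - pt k i| ≤ 1 / N := by
        rw [le_div_iff₀ hN0']
        linarith
      exact pow_le_pow_left₀ (norm_nonneg _) h3 2
    have hη2 : √d / N ≤ η := by
      rw [div_le_iff₀ hη] at hNle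
      rw [div_le_iff₀ hN0']
      nlinarith [Real.sqrt_nonneg d]
    refine le_trans ?_ hη2
    rw [EuclideanSpace.norm_eq]
    refine Real.sqrt_le_iff.2 ⟨by positivity, ?_⟩
    refine (Finset.sum_le_sum fun i _ => hcoord i).trans (le_of_eq ?_)
    rw [Finset.sum_const, Finset.card_univ, Fintype.card_fin, nsmul_eq_mul, div_pow, div_pow,
      Real.sq_sqrt (by positivity)]
    ring

/-! ### Upper bound for the convex hull -/

/-- If a compact convex subset `C` of `K` is at a Hausdorff distance from `K` greater than `δ`,
then a point of `K` is separated from `C` by a slab of width `δ`. -/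
theorem exists_separation_of_lt_hausdorffEDist {d : ℕ} {C K : Set (Euc d)} (hC : IsCompact C)
    (hCc : Convex ℝ C) (hCn : C.Nonempty) (hCK : C ⊆ K) {δ : ℝ} (hδ : 0 ≤ δ)
    (h : ENNReal.ofReal δ < Metric.hausdorffEDist C K) :
    ∃ u : Euc d, ‖u‖ = 1 ∧ ∃ x ∈ K, ∀ z ∈ C, inner ℝ u z + δ ≤ inner ℝ u x := by
  by_contra! hcon
  refine h.not_ge (Metric.hausdorffEDist_le_of_mem_edist (fun x hx => ⟨x, hCK hx, by simp⟩) ?_)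
  intro x hx
  -- With `y` the projection of `x` onto `C`, the direction x - y separates: ⟨x - y, z - y⟩ ≤ 0 on
  -- `C`.
  obtain ⟨y, hy, hmin⟩ := exists_norm_eq_iInf_of_complete_convex hCn hC.isComplete hCc x
  rw [norm_eq_iInf_iff_real_inner_le_zero hCc hy] at hmin
  refine ⟨y, hy, ?_⟩
  by_contra! hlt
  rw [edist_dist, ENNReal.ofReal_lt_ofReal_iff_of_nonneg hδ, dist_eq_norm] at hlt
  have hpos : 0 < ‖x - y‖ := hδ.trans_lt hlt
  obtain ⟨z, hz, hzlt⟩ := hcon (‖x - y‖⁻¹ • (x - y)) (by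
    rw [norm_smul, norm_inv, norm_norm, inv_mul_cancel₀ hpos.ne']) x hx
  have h1 := hmin z hz
  have h2 : inner ℝ (x - y) (x - y) = ‖x - y‖ ^ 2 := real_inner_self_eq_norm_sq _
  rw [inner_sub_right] at h1 h2
  rw [real_inner_smul_left, real_inner_smul_left] at hzlt
  have h3 := mul_lt_mul_of_pos_left hzlt hpos
  rw [mul_add, mul_inv_cancel_left₀ hpos.ne', mul_inv_cancel_left₀ hpos.ne'] at h3
  nlinarith

theorem isCompact_randomPolytope {d n : ℕ} (X : Fin n → Euc d) :
    IsCompact (randomPolytope d n X) :=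
  (Set.finite_range X).isCompact_convexHull ℝ

/-- The random polytope is a set estimator: its graph is closed. -/
theorem isSetEstimator_randomPolytope (d n : ℕ) : IsSetEstimator (randomPolytope d n) := by
  refine ⟨isCompact_randomPolytope, IsClosed.measurableSet ?_⟩
  -- The graph is the projection of this closed set along the compact simplex of weights.
  let S : Set (((Fin n → Euc d) × Euc d) × stdSimplex ℝ (Fin n)) :=
    {p | p.1.2 = ∑ i, (p.2 : Fin n → ℝ) i • p.1.1 i}
  have hS : IsClosed S := by
    refine isClosed_eq (by fun_prop) (continuous_finsetSum _ fun i _ => ?_)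
    exact ((continuous_apply i).comp (continuous_subtype_val.comp continuous_snd)).smul
      ((continuous_apply i).comp (continuous_fst.comp continuous_fst))
  convert isClosedMap_fst_of_compactSpace _ hS using 1
  ext ⟨X, y⟩
  simp only [randomPolytope, Set.mem_ofPred_eq, Set.mem_image]
  have hX : Set.range X = Fintype.linearCombination ℝ X '' Set.range fun i => Pi.single i (1 : ℝ) := by
    rw [← Set.range_comp]
    congr 1
    ext1 i
    simp
  rw [hX, ← (Fintype.linearCombination ℝ X).image_convexHull, convexHull_rangle_single_eq_stdSimplex]
  constructor
  · rintro ⟨w, hw, rfl⟩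
    exact ⟨((X, _), ⟨w, hw⟩), Fintype.linearCombination_apply ℝ X w, rfl⟩
  · rintro ⟨⟨⟨X', y'⟩, w⟩, hp, hpe⟩
    obtain ⟨rfl, rfl⟩ := Prod.mk.inj hpe
    exact ⟨w, w.2, (Fintype.linearCombination_apply ℝ X' w).trans hp.symm⟩

theorem uniformSample_setOf_forall_mem {d n : ℕ} (K : ConvexBody (Euc d)) (s : Set (Euc d)) :
    uniformSample n K {X | ∀ i, X i ∈ s} = cond volume (K : Set (Euc d)) s ^ n := by
  have : {X : Fin n → Euc d | ∀ i, X i ∈ s} = Set.univ.pi fun _ => s := by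
    ext X; simp
  rw [this, uniformSample, Measure.pi_pi]
  simp

theorem ae_uniformSample_mem {d : ℕ} {r : ℝ} {K : ConvexBody (Euc d)}
    (hK : K ∈ rollingBodies d r) (n : ℕ) :
    ∀ᵐ X ∂uniformSample n K, ∀ i, X i ∈ (K : Set (Euc d)) := by
  have := isProbabilityMeasure_cond_of_mem_rollingBodies hK
  rw [ae_all_iff]
  exact fun i => (Measure.quasiMeasurePreserving_eval _ i).ae
    (ae_cond_mem K.isClosed.measurableSet)

/-- The convex hull of the sample is `2 σ ^ 2`-close to the body with high probability. -/
theorem uniformSample_lt_hausdorffEDist_le {d n : ℕ} {r : ℝ} {K : ConvexBody (Euc d)}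
    (hK : K ∈ rollingBodies d r) (hn : 1 ≤ n) {σ p : ℝ} (hp : 0 ≤ p) {F : Finset (Euc d)}
    (hF : ∀ u : Euc d, ‖u‖ = 1 → ∃ v ∈ F, ‖u - v‖ ≤ σ ^ 2 / 2)
    (hcap : ∀ v ∈ F, ∃ h : ℝ, (∀ y ∈ K, inner ℝ v y ≤ h) ∧
      ENNReal.ofReal p ≤ cond volume (K : Set (Euc d)) {y | h - σ ^ 2 < inner ℝ v y}) :
    uniformSample n K {X | ENNReal.ofReal (2 * σ ^ 2) <
        Metric.hausdorffEDist (randomPolytope d n X) K} ≤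
      ENNReal.ofReal (F.card * Real.exp (-(n * p))) := by
  have := isProbabilityMeasure_cond_of_mem_rollingBodies hK
  choose! h hh hc using hcap
  have hae := ae_uniformSample_mem hK n
  have hsub : ∀ᵐ X ∂uniformSample n K, X ∈ {X | ENNReal.ofReal (2 * σ ^ 2) <
        Metric.hausdorffEDist (randomPolytope d n X) K} →
      X ∈ ⋃ v ∈ F, {X : Fin n → Euc d | ∀ i, X i ∈ {y | h v - σ ^ 2 < inner ℝ v y}ᶜ} := by
    filter_upwards [hae] with X hX hlt
    have hne : (randomPolytope d n X).Nonempty :=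
      ⟨X ⟨0, hn⟩, subset_convexHull _ _ (Set.mem_range_self _)⟩
    obtain ⟨u, hu, x, hx, hsep⟩ := exists_separation_of_lt_hausdorffEDist
      (isCompact_randomPolytope X) (convex_convexHull _ _) hne
      (convexHull_min (Set.range_subset_iff.2 hX) K.convex) (by positivity) hlt
    -- Replacing `u` by `v` costs σ²/2 at `x` and at each observation, so a slab of width σ² remains
    -- of the original 2σ².
    obtain ⟨v, hv, huv⟩ := hF u hu
    simp only [Set.mem_iUnion]
    refine ⟨v, hv, fun i => ?_⟩
    simp only [Set.mem_compl_iff, Set.mem_ofPred_eq, not_lt]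
    have key : ∀ y ∈ (K : Set (Euc d)), |inner ℝ u y - inner ℝ v y| ≤ σ ^ 2 / 2 := by
      intro y hy
      rw [← inner_sub_left]
      have h1 : ‖y‖ ≤ 1 := by simpa using hK.2.1 hy
      calc |inner ℝ (u - v) y| ≤ ‖u - v‖ * ‖y‖ := abs_real_inner_le_norm _ _
        _ ≤ σ ^ 2 / 2 * 1 := by gcongr
        _ = σ ^ 2 / 2 := mul_one _
    have h1 := hsep (X i) (subset_convexHull _ _ (Set.mem_range_self i))
    have h2 := (abs_le.1 (key _ (hX i))).1
    have h3 := (abs_le.1 (key _ hx)).2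
    have h4 := hh v hv x hx
    linarith
  refine (measure_mono_ae hsub).trans ((measure_biUnion_finset_le _ _).trans ?_)
  rw [ENNReal.ofReal_mul (by positivity), ENNReal.ofReal_natCast, ← nsmul_eq_mul]
  refine Finset.sum_le_card_nsmul _ _ _ fun v hv => ?_
  rw [uniformSample_setOf_forall_mem, ← mul_neg, Real.exp_nat_mul,
    ENNReal.ofReal_pow (Real.exp_pos _).le]
  refine pow_le_pow_left' ?_ n
  have hm : MeasurableSet {y : Euc d | h v - σ ^ 2 < inner ℝ v y} :=
    (isOpen_lt continuous_const (by fun_prop)).measurableSet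
  rw [prob_compl_eq_one_sub hm]
  refine (tsub_le_tsub_left (hc v hv) 1).trans ?_
  rw [← ENNReal.ofReal_one, ← ENNReal.ofReal_sub _ hp]
  refine ENNReal.ofReal_le_ofReal ?_
  linarith [Real.add_one_le_exp (-p)]

/-- Crude diameter bound from the unit ball, for the exceptional event and for scales beyond the
range of the cap estimate. -/
theorem hausdorffEDist_randomPolytope_le_two {d n : ℕ} {r : ℝ} {K : ConvexBody (Euc d)}
    (hK : K ∈ rollingBodies d r) (hn : 1 ≤ n) :
    ∀ᵐ X ∂uniformSample n K, Metric.hausdorffEDist (randomPolytope d n X) K ≤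
      ENNReal.ofReal 2 := by
  have := isProbabilityMeasure_cond_of_mem_rollingBodies hK
  have hae := ae_uniformSample_mem hK n
  filter_upwards [hae] with X hX
  have hsub : randomPolytope d n X ⊆ K := convexHull_min (Set.range_subset_iff.2 hX) K.convex
  refine Metric.hausdorffEDist_le_of_mem_edist (fun x hx => ⟨x, hsub hx, by simp⟩) fun x hx =>
    ⟨X ⟨0, hn⟩, subset_convexHull _ _ (Set.mem_range_self _), ?_⟩
  rw [edist_dist]
  refine ENNReal.ofReal_le_ofReal ?_
  have h1 := hK.2.1 hx
  have h2 := hK.2.1 (hX ⟨0, hn⟩)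
  rw [mem_closedBall_zero_iff] at h1 h2
  rw [dist_eq_norm]
  linarith [norm_sub_le x (X ⟨0, hn⟩)]

/-- A bound on the moments of a bounded function from a tail bound. -/
theorem lintegral_rpow_le_of_measure_lt_le {Ω : Type*} [MeasurableSpace Ω] {μ : Measure Ω}
    [IsProbabilityMeasure μ] {f : Ω → ℝ≥0∞} {a b p : ℝ≥0∞} {q : ℝ} (hq : 0 ≤ q)
    (hb : ∀ᵐ x ∂μ, f x ≤ b) (hp : μ {x | a < f x} ≤ p) :
    ∫⁻ x, f x ^ q ∂μ ≤ a ^ q + b ^ q * p := by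
  -- No measurability of `f` is assumed, so the event is replaced by its measurable hull.
  set B := toMeasurable μ {x | a < f x}
  have hle : ∀ᵐ x ∂μ, f x ^ q ≤ a ^ q + B.indicator (fun _ => b ^ q) x := by
    filter_upwards [hb] with x hx
    by_cases hxB : x ∈ B
    · rw [Set.indicator_of_mem hxB]
      exact (ENNReal.rpow_le_rpow hx hq).trans le_add_self
    · rw [Set.indicator_of_notMem hxB, add_zero]
      refine ENNReal.rpow_le_rpow (not_lt.1 fun hlt => hxB ?_) hq
      exact subset_toMeasurable _ _ hlt
  refine (lintegral_mono_ae hle).trans ?_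
  rw [lintegral_add_left measurable_const, lintegral_const, measure_univ, mul_one,
    lintegral_indicator_const (measurableSet_toMeasurable _ _), measure_toMeasurable]
  gcongr

instance {d n : ℕ} (K : ConvexBody (Euc d)) [IsProbabilityMeasure (cond volume (K : Set (Euc d)))] :
    IsProbabilityMeasure (uniformSample n K) := by
  rw [uniformSample]; infer_instance

/-- `(ln n / n) ^ (1 / (d + 1))` for `d = m + 1`. -/
noncomputable def rateBase (m n : ℕ) : ℝ := (Real.log n / n) ^ (1 / ((m : ℝ) + 2))

/-- This makes `rateBase` the scale at which caps of height `rateBase ^ 2` have mass of order `ln n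
/ n`. -/
theorem rateBase_pow (m n : ℕ) : rateBase m n ^ (m + 2) = Real.log n / n := by
  rw [rateBase, ← Real.rpow_natCast, ← Real.rpow_mul (by positivity)]
  push_cast
  rw [one_div_mul_cancel (by positivity), Real.rpow_one]

theorem rate_eq (m n : ℕ) (q : ℝ) : rate (m + 1) q n = (rateBase m n ^ 2) ^ q := by
  rw [rate, rateBase, ← Real.rpow_natCast, ← Real.rpow_mul (by positivity),
    ← Real.rpow_mul (by positivity)]
  congr 1
  push_cast
  ring

theorem rateBase_pos {n : ℕ} (m : ℕ) (hn : 2 ≤ n) : 0 < rateBase m n := by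
  have h2 : (2 : ℝ) ≤ n := by exact_mod_cast hn
  have := Real.log_pos (by linarith : (1 : ℝ) < n)
  unfold rateBase
  positivity

theorem rateBase_le_one {n : ℕ} (m : ℕ) (hn : 2 ≤ n) : rateBase m n ≤ 1 := by
  have h2 : (2 : ℝ) ≤ n := by exact_mod_cast hn
  refine Real.rpow_le_one (by positivity) ?_ (by positivity)
  rw [div_le_one (by linarith)]
  linarith [Real.log_le_sub_one_of_pos (by linarith : (0 : ℝ) < n)]

/-- A polynomial lower bound: it keeps the net polynomial in `n` and absorbs the failure probability
into the rate. -/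
theorem one_div_two_mul_le_rateBase {n : ℕ} (m : ℕ) (hn : 2 ≤ n) :
    1 / (2 * (n : ℝ)) ≤ rateBase m n := by
  have h2 : (2 : ℝ) ≤ n := by exact_mod_cast hn
  have hlog : 1 / 2 ≤ Real.log n :=
    (by linarith [Real.log_two_gt_d9] : 1 / 2 ≤ Real.log 2).trans
      (Real.log_le_log (by norm_num) h2)
  calc 1 / (2 * (n : ℝ)) = 1 / 2 / n := by ring
    _ ≤ Real.log n / n := by gcongr
    _ = rateBase m n ^ (m + 2) := (rateBase_pow m n).symm
    _ ≤ rateBase m n := pow_le_of_le_one (rateBase_pos m hn).le (rateBase_le_one m hn) (by omega)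

/-- The maximal risk of the random polytope is of the order of the rate. -/
theorem exists_maxRisk_randomPolytope_le (m : ℕ) {r : ℝ} (hr0 : 0 < r) (hr1 : r < 1) {q : ℝ}
    (hq : 1 ≤ q) : ∃ C : ℝ, 0 < C ∧ ∀ n : ℕ, 2 ≤ n →
      maxRisk r q (randomPolytope (m + 1) n) ≤ ENNReal.ofReal (C * rate (m + 1) q n) := by
  obtain ⟨κ, hκ, hcap⟩ := exists_le_cond_cap m hr0
  obtain ⟨A, hA, hnet⟩ := exists_finset_unit_net (m + 1)
  set d : ℕ := m + 1 with hd
  -- Chosen so that κ B^(m+2) ≥ 2d + 2q: each cap is empty with probability at most n^(-2d-2q). The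
  -- net costs n^(2d), and n^(-2q) ≤ (4ρ²)^q remains.
  set B : ℝ := 1 + (2 * d + 2 * q) / κ with hB
  have hq0 : 0 < q := by linarith
  have hB1 : 1 ≤ B := by rw [hB]; linarith [show 0 ≤ (2 * d + 2 * q) / κ by positivity]
  have hB0 : 0 < B := by linarith
  -- The first term covers the typical distance 2B²ρ²; dividing by `r` makes it also cover the case
  -- (Bρ)² > r, where the distance is at most 2. The second is the exceptional event.
  refine ⟨(2 * B ^ 2 / r) ^ q + 2 ^ q * ((8 * A) ^ d * 4 ^ q), by positivity, fun n hn => ?_⟩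
  have hn2 : (2 : ℝ) ≤ n := by exact_mod_cast hn
  have hn0 : (0 : ℝ) < n := by linarith
  set ρ := rateBase m n with hρ
  have hρ0 : 0 < ρ := rateBase_pos m hn
  have hρ1 : ρ ≤ 1 := rateBase_le_one m hn
  have hρn : 1 / (2 * (n : ℝ)) ≤ ρ := one_div_two_mul_le_rateBase m hn
  rw [rate_eq, ← hρ]
  refine iSup₂_le fun K hK => ?_
  have := isProbabilityMeasure_cond_of_mem_rollingBodies hK
  have h2 := hausdorffEDist_randomPolytope_le_two hK (n := n) (by omega)
  have hσ0 : 0 < B * ρ := by positivity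
  rw [risk]
  rcases le_or_gt ((B * ρ) ^ 2) r with hσr | hσr
  · obtain ⟨F, hF1, hFc, hF⟩ := hnet ((B * ρ) ^ 2 / 2) (by positivity) (by linarith)
    have hP := uniformSample_lt_hausdorffEDist_le hK (n := n) (by omega)
      (p := κ * (B * ρ) ^ (m + 2)) (by positivity) hF
      (fun v hv => hcap K hK v (hF1 v hv) _ hσ0 hσr)
    refine (lintegral_rpow_le_of_measure_lt_le hq0.le h2 hP).trans ?_
    rw [ENNReal.ofReal_rpow_of_nonneg (by positivity) hq0.le,
      ENNReal.ofReal_rpow_of_nonneg (by positivity) hq0.le,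
      ← ENNReal.ofReal_mul (by positivity), ← ENNReal.ofReal_add (by positivity) (by positivity)]
    refine ENNReal.ofReal_le_ofReal ?_
    have hexp : Real.exp (-(n * (κ * (B * ρ) ^ (m + 2)))) ≤ (n : ℝ) ^ (-(2 * d + 2 * q)) := by
      rw [Real.rpow_def_of_pos hn0, mul_pow, rateBase_pow]
      refine Real.exp_le_exp.2 ?_
      have h1 : 2 * d + 2 * q ≤ κ * B ^ (m + 2) := by
        calc 2 * d + 2 * q ≤ κ * B := by
              rw [hB, mul_add, mul_div_cancel₀ _ hκ.ne']; linarith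
          _ ≤ κ * B ^ (m + 2) := by
              gcongr
              exact le_self_pow₀ hB1 (by omega)
      have h3 : 0 ≤ Real.log n := Real.log_nonneg (by linarith)
      have h4 : n * (κ * (B ^ (m + 2) * (Real.log n / n))) = Real.log n * (κ * B ^ (m + 2)) := by
        field_simp
      rw [h4]
      nlinarith
    have hcard : (F.card : ℝ) ≤ (8 * A) ^ d * (n : ℝ) ^ (2 * d : ℝ) := by
      have h1 : (n : ℝ) ^ (2 * d : ℝ) = ((n : ℝ) ^ 2) ^ d := by
        rw [← pow_mul, ← Real.rpow_natCast]
        push_cast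
        rfl
      rw [h1, ← mul_pow]
      refine hFc.trans (pow_le_pow_left₀ (by positivity) ?_ d)
      rw [div_le_iff₀ (by positivity)]
      have h3 : 1 ≤ B * ρ * (2 * n) := by
        rw [div_le_iff₀ (by positivity)] at hρn
        nlinarith [mul_pos hρ0 hn0]
      have h4 : 1 ≤ (B * ρ * (2 * n)) ^ 2 := one_le_pow₀ h3
      calc A = A * 1 := (mul_one A).symm
        _ ≤ A * (B * ρ * (2 * n)) ^ 2 := by gcongr
        _ = 8 * A * (n : ℝ) ^ 2 * ((B * ρ) ^ 2 / 2) := by ring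
    have hprod : (F.card : ℝ) * Real.exp (-(n * (κ * (B * ρ) ^ (m + 2)))) ≤
        (8 * A) ^ d * (4 ^ q * (ρ ^ 2) ^ q) := by
      calc (F.card : ℝ) * Real.exp (-(n * (κ * (B * ρ) ^ (m + 2))))
          ≤ (8 * A) ^ d * (n : ℝ) ^ (2 * d : ℝ) * (n : ℝ) ^ (-(2 * d + 2 * q)) := by gcongr
        _ = (8 * A) ^ d * (((1 / (n : ℝ)) ^ 2) ^ q) := by
            rw [mul_assoc, ← Real.rpow_add hn0, one_div, inv_pow, Real.inv_rpow (by positivity),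
              ← Real.rpow_natCast (n : ℝ) 2, ← Real.rpow_mul hn0.le, ← Real.rpow_neg hn0.le]
            congr 2
            push_cast
            ring
        _ ≤ (8 * A) ^ d * ((4 * ρ ^ 2) ^ q) := by
            gcongr
            rw [div_le_iff₀ (by positivity)] at hρn
            rw [show 4 * ρ ^ 2 = (2 * ρ) ^ 2 by ring]
            gcongr
            rw [div_le_iff₀ hn0]
            linarith
        _ = (8 * A) ^ d * (4 ^ q * (ρ ^ 2) ^ q) := by
            rw [Real.mul_rpow (by norm_num) (by positivity)]
    have hmain : (2 * (B * ρ) ^ 2) ^ q ≤ (2 * B ^ 2 / r) ^ q * (ρ ^ 2) ^ q := by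
      rw [← Real.mul_rpow (by positivity) (by positivity)]
      rw [mul_pow, ← mul_assoc]
      have := le_div_self (by positivity : 0 ≤ 2 * B ^ 2) hr0 hr1.le
      gcongr
    calc _ ≤ (2 * B ^ 2 / r) ^ q * (ρ ^ 2) ^ q + 2 ^ q * ((8 * A) ^ d * (4 ^ q * (ρ ^ 2) ^ q)) := by
          gcongr
      _ = _ := by ring
  · have h3 : ∀ᵐ X ∂uniformSample n K,
        Metric.hausdorffEDist (randomPolytope d n X) (K : Set (Euc d)) ^ q ≤
          ENNReal.ofReal 2 ^ q := by
      filter_upwards [h2] with X hX using ENNReal.rpow_le_rpow hX hq0.le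
    refine (lintegral_mono_ae h3).trans ?_
    rw [lintegral_const, measure_univ, mul_one,
      ENNReal.ofReal_rpow_of_nonneg (by positivity) hq0.le]
    refine ENNReal.ofReal_le_ofReal ?_
    rw [add_mul, ← Real.mul_rpow (by positivity) (by positivity)]
    refine le_trans ?_ (le_add_of_nonneg_right (by positivity))
    gcongr
    rw [div_mul_eq_mul_div, le_div_iff₀ hr0]
    nlinarith

/-! ### Flattened balls and conditioned samples -/

/-- A well-separated family of `k ^ m` unit vectors of `ℝ^(m+1)`. -/
theorem exists_separated_unit_vectors (m : ℕ) {k : ℕ} (hk : 1 ≤ k) :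
    ∃ u : (Fin m → Fin k) → Euc (m + 1), (∀ j, ‖u j‖ = 1) ∧
      ∀ i j, i ≠ j → 1 / (k * (m + 1) : ℝ) ≤ ‖u i - u j‖ := by
  have hk0 : (0 : ℝ) < k := by exact_mod_cast hk
  -- A grid in ℝ^m, lifted to the sphere by the first coordinate; the factor m + 1 keeps it in the
  -- unit ball.
  let y : (Fin m → Fin k) → Fin m → ℝ := fun j i => ((j i : ℕ) : ℝ) / (k * (m + 1))
  have hy : ∀ j, ∑ i, y j i ^ 2 ≤ 1 := by
    intro j
    have h1 : ∀ i, y j i ^ 2 ≤ (1 / (m + 1 : ℝ)) ^ 2 := by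
      intro i
      have h2 : ((j i : ℕ) : ℝ) ≤ k := by exact_mod_cast (j i).2.le
      refine pow_le_pow_left₀ (by positivity) ?_ 2
      rw [div_le_div_iff₀ (by positivity) (by positivity)]
      nlinarith
    refine (Finset.sum_le_sum fun i _ => h1 i).trans ?_
    rw [Finset.sum_const, Finset.card_univ, Fintype.card_fin, nsmul_eq_mul, div_pow, one_pow,
      mul_one_div, div_le_one (by positivity)]
    nlinarith
  refine ⟨fun j => WithLp.toLp 2 (Fin.cons √(1 - ∑ i, y j i ^ 2) (y j)), fun j => ?_, ?_⟩
  · rw [EuclideanSpace.norm_eq, Fin.sum_univ_succ]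
    simp only [Fin.cons_zero, Fin.cons_succ, Real.norm_eq_abs, sq_abs]
    rw [Real.sq_sqrt (by linarith [hy j]), sub_add_cancel, Real.sqrt_one]
  · intro i j hij
    obtain ⟨l, hl⟩ := Function.ne_iff.1 hij
    refine le_trans ?_ (PiLp.norm_apply_le _ l.succ)
    have h1 : (1 : ℝ) ≤ |((i l : ℕ) : ℝ) - (j l : ℕ)| := by
      have h2 : ((i l : ℕ) : ℤ) - (j l : ℕ) ≠ 0 := by
        rw [sub_ne_zero]
        exact fun h => hl (Fin.ext (by exact_mod_cast h))
      exact_mod_cast Int.one_le_abs h2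
    show _ ≤ |y i l - y j l|
    simp only [y]
    rw [← sub_div, abs_div, abs_of_pos (by positivity : (0 : ℝ) < k * (m + 1))]
    gcongr

/-- Each point x of the unit ball lies in the ball of radius r about (1 - r)x. The unit ball is the
null hypothesis of the lower bound. -/
theorem exists_unitBall_mem_rollingBodies (d : ℕ) {r : ℝ} (hr0 : 0 < r) (hr1 : r < 1) :
    ∃ K ∈ rollingBodies d r, (K : Set (Euc d)) = Metric.closedBall 0 1 := by
  refine ⟨⟨Metric.closedBall 0 1, convex_closedBall _ _, isCompact_closedBall _ _,
    ⟨0, by simp⟩⟩, ⟨Metric.measure_closedBall_pos _ _ one_pos, subset_rfl, ?_⟩, rfl⟩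
  intro x hx
  have hx1 : ‖x‖ ≤ 1 := by simpa using Metric.isClosed_closedBall.frontier_subset hx
  refine ⟨(1 - r) • x, ?_, Metric.closedBall_subset_closedBall' ?_⟩
  · rw [mem_closedBall_iff_norm, show x - (1 - r) • x = r • x by module, norm_smul,
      Real.norm_of_nonneg hr0.le]
    nlinarith
  · rw [dist_zero_right, norm_smul, Real.norm_of_nonneg (by linarith)]
    nlinarith

/-- The unit ball flattened in the direction `u` by `h`, in such a way that the rolling condition
is preserved: only points of a cap of height `h / (1 - r)` are lost. -/
theorem exists_flattened_ball {d : ℕ} {r : ℝ} (hr0 : 0 < r) (hr1 : r < 1) {u : Euc d}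
    (hu : ‖u‖ = 1) {h : ℝ} (hh1 : h ≤ 1 - r) :
    ∃ K ∈ rollingBodies d r, (∀ x ∈ K, inner ℝ u x ≤ 1 - h) ∧
      Metric.closedBall 0 1 \ (K : Set (Euc d)) ⊆
        {x | x ∈ Metric.closedBall 0 1 ∧ 1 - h / (1 - r) ≤ inner ℝ u x} := by
  have hr : 0 < 1 - r := by linarith
  -- The body is the `r`-neighbourhood of a truncated ball of radius 1 - r, so rolling is automatic.
  -- If x is lost, then (1 - r)x lies beyond the truncation, which gives the height h/(1 - r).
  set S : Set (Euc d) := Metric.closedBall 0 (1 - r) ∩ {a | inner ℝ u a ≤ 1 - r - h} with hS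
  have hSc : IsCompact S := (isCompact_closedBall _ _).inter_right
    (isClosed_le (by fun_prop) continuous_const)
  have hSconv : Convex ℝ S := (convex_closedBall _ _).inter
    (convex_halfSpace_le (innerSL ℝ u).isLinear _)
  have h0S : (0 : Euc d) ∈ S := ⟨by simp [hr.le], by
    show inner ℝ u 0 ≤ 1 - r - h
    rw [inner_zero_right]; linarith⟩
  have hmem : ∀ x, x ∈ Metric.cthickening r S ↔ ∃ a ∈ S, x ∈ Metric.closedBall a r := fun x => by
    rw [hSc.cthickening_eq_biUnion_closedBall hr0.le]
    simp only [Set.mem_iUnion, exists_prop]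
  have hball : ∀ a ∈ S, Metric.closedBall a r ⊆ Metric.cthickening r S :=
    fun a ha x hx => (hmem x).2 ⟨a, ha, hx⟩
  let K : ConvexBody (Euc d) := ⟨Metric.cthickening r S, hSconv.cthickening r, hSc.cthickening,
    ⟨0, hball 0 h0S (Metric.mem_closedBall_self hr0.le)⟩⟩
  refine ⟨K, ⟨?_, ?_, ?_⟩, ?_, ?_⟩
  · exact (Metric.measure_closedBall_pos volume (0 : Euc d) hr0).trans_le
      (measure_mono (hball 0 h0S))
  · intro x hx
    obtain ⟨a, ha, hx⟩ := (hmem x).1 hx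
    refine Metric.closedBall_subset_closedBall' ?_ hx
    linarith [Metric.mem_closedBall.1 ha.1]
  · intro x hx
    obtain ⟨a, ha, hxa⟩ := (hmem x).1 (K.isClosed.frontier_subset hx)
    exact ⟨a, hxa, hball a ha⟩
  · intro x hx
    obtain ⟨a, ha, hx⟩ := (hmem x).1 hx
    have h1 := real_inner_le_norm u (x - a)
    have h2 : inner ℝ u a ≤ 1 - r - h := ha.2
    rw [hu, one_mul, inner_sub_right] at h1
    rw [mem_closedBall_iff_norm] at hx
    linarith
  · rintro x ⟨hx, hxK⟩
    refine ⟨hx, ?_⟩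
    by_contra! hlt
    rw [mem_closedBall_zero_iff] at hx
    refine hxK ((hmem x).2 ⟨(1 - r) • x, ⟨?_, ?_⟩, ?_⟩)
    · rw [mem_closedBall_zero_iff, norm_smul, Real.norm_of_nonneg hr.le]
      nlinarith
    · show inner ℝ u ((1 - r) • x) ≤ 1 - r - h
      rw [inner_smul_right]
      have h3 := mul_lt_mul_of_pos_left hlt hr
      rw [mul_sub, mul_div_cancel₀ _ hr.ne'] at h3
      linarith
    · rw [mem_closedBall_iff_norm, show x - (1 - r) • x = r • x by module, norm_smul,
        Real.norm_of_nonneg hr0.le]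
      nlinarith

theorem pi_cond {α ι : Type*} [MeasurableSpace α] [Fintype ι] {μ : Measure α}
    [IsProbabilityMeasure μ] {s : Set α} (hs : MeasurableSet s) (hμs : μ s ≠ 0) :
    Measure.pi (fun _ : ι => cond μ s) =
      cond (Measure.pi fun _ : ι => μ) {X | ∀ i, X i ∈ s} := by
  have := cond_isProbabilityMeasure hμs
  have hE : {X : ι → α | ∀ i, X i ∈ s} = Set.univ.pi fun _ => s := by ext X; simp
  refine Measure.pi_eq fun t _ => ?_
  rw [hE, cond_apply (MeasurableSet.univ_pi fun _ => hs), ← Set.pi_inter_distrib, Measure.pi_pi,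
    Measure.pi_pi]
  simp_rw [cond_apply hs]
  rw [Finset.prod_mul_distrib]
  simp [ENNReal.inv_pow]

/-- Conditioning acts coordinatewise on product laws; this places all alternatives on the
probability space of the larger body. -/
theorem uniformSample_eq_cond {d n : ℕ} {K L : ConvexBody (Euc d)}
    (hKL : (K : Set (Euc d)) ⊆ L) (hK : volume (K : Set (Euc d)) ≠ 0) :
    uniformSample n K = cond (uniformSample n L) {X | ∀ i, X i ∈ (K : Set (Euc d))} := by
  have hL : volume (L : Set (Euc d)) ≠ ∞ := L.isCompact.measure_lt_top.ne
  have := cond_isProbabilityMeasure_of_finite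
    (fun h => hK (measure_mono_null hKL h) : volume (L : Set (Euc d)) ≠ 0) hL
  have hKm := K.isClosed.measurableSet
  have hLm := L.isClosed.measurableSet
  have hcond : cond (cond volume (L : Set (Euc d))) (K : Set (Euc d)) =
      cond volume (K : Set (Euc d)) := by
    rw [cond_cond_eq_cond_inter' hLm hKm hL, Set.inter_eq_self_of_subset_right hKL]
  rw [uniformSample, uniformSample, ← hcond, pi_cond hKm]
  rw [cond_apply hLm, Set.inter_eq_self_of_subset_right hKL]
  exact mul_ne_zero (ENNReal.inv_ne_zero.2 hL) hK

/-! ### Second-moment bound for testing -/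

/-- A test between a distribution `P` and its conditionings to many weakly dependent events cannot
have small errors. -/
theorem exists_error_ge_of_weakly_dependent {Ω ι : Type*} [MeasurableSpace Ω] [Fintype ι]
    {P : Measure Ω} [IsProbabilityMeasure P] {E A : ι → Set Ω}
    (hE : ∀ i, MeasurableSet (E i)) (hA : ∀ i, NullMeasurableSet (A i) P) {e : ℝ} (he : 0 < e)
    (hEe : ∀ i, e ≤ P.real (E i)) (hcard : 16 ≤ Fintype.card ι * e)
    (hcorr : ∀ i j, i ≠ j → P.real (E i ∩ E j) ≤ P.real (E i) * P.real (E j)) :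
    1 / 4 ≤ P.real (⋃ i, A i) ∨ ∃ i, 1 / 4 ≤ (P.real (E i))⁻¹ * P.real (E i ∩ (A i)ᶜ) := by
  classical
  set M : ℝ := (Fintype.card ι : ℝ) with hM
  have hM0 : 0 < M := by
    by_contra! h
    nlinarith
  have he0 : ∀ i, 0 < P.real (E i) := fun i => he.trans_le (hEe i)
  -- Σ c_i 1_{E_i} is the density with respect to `P` of the uniform mixture of the conditioned
  -- laws.
  set c : ι → ℝ := fun i => (M * P.real (E i))⁻¹ with hc
  have hc0 : ∀ i, 0 ≤ c i := fun i => by have := he0 i; positivity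
  have hce : ∀ i, c i * P.real (E i) = M⁻¹ := fun i => by
    have := he0 i
    simp only [hc]
    field_simp
  have hc16 : ∀ i, c i ≤ 1 / 16 := fun i => by
    rw [hc, one_div]
    refine inv_anti₀ (by norm_num) (hcard.trans ?_)
    gcongr
    exact hEe i
  let χ : Set Ω → Ω → ℝ := fun S => S.indicator 1
  have hχ : ∀ S, NullMeasurableSet S P → Integrable (χ S) P ∧ ∫ x, χ S x ∂P = P.real S := by
    intro S hS
    have h1 : χ (toMeasurable P S) =ᵐ[P] χ S := indicator_ae_eq_of_ae_eq_set hS.toMeasurable_ae_eq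
    have hm := measurableSet_toMeasurable P S
    refine ⟨((integrable_const (1 : ℝ)).indicator hm).congr h1, ?_⟩
    rw [← integral_congr_ae h1, integral_indicator_one hm]
    exact measureReal_congr hS.toMeasurable_ae_eq
  have hEn := fun i => (hE i).nullMeasurableSet (μ := P)
  have hEE := fun i j => ((hE i).inter (hE j)).nullMeasurableSet (μ := P)
  have hEA := fun i => (hEn i).inter (hA i).compl
  have hU : NullMeasurableSet (⋃ i, A i) P := NullMeasurableSet.iUnion hA
  -- With L the mixture density, the quadratic -9/8 + 4L - 2L² is at most L (the gap is 2(L - 3/4)²)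
  -- and at most 1, so it bounds the error integrand from below. Integrating with E L = 1 and E L² ≤
  -- 17/16 leaves 3/4.
  have hpt : ∀ x, -(9 / 8) + 4 * ∑ i, c i * χ (E i) x -
      2 * ∑ i, ∑ j, c i * c j * χ (E i ∩ E j) x ≤
      ∑ i, c i * χ (E i ∩ (A i)ᶜ) x + χ (⋃ i, A i) x := by
    intro x
    have hsq : ∑ i, ∑ j, c i * c j * χ (E i ∩ E j) x = (∑ i, c i * χ (E i) x) ^ 2 := by
      rw [sq, Finset.sum_mul_sum]
      refine Finset.sum_congr rfl fun i _ => Finset.sum_congr rfl fun j _ => ?_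
      simp only [χ, Set.inter_indicator_one, Pi.mul_apply]
      ring
    rw [hsq]
    set L := ∑ i, c i * χ (E i) x
    by_cases hx : x ∈ ⋃ i, A i
    · have h1 : χ (⋃ i, A i) x = 1 := Set.indicator_of_mem hx _
      have h2 : 0 ≤ ∑ i, c i * χ (E i ∩ (A i)ᶜ) x := Finset.sum_nonneg fun i _ =>
        mul_nonneg (hc0 i) (Set.indicator_nonneg (fun _ _ => zero_le_one) x)
      nlinarith [sq_nonneg (L - 1)]
    · have h1 : χ (⋃ i, A i) x = 0 := Set.indicator_of_notMem hx _
      have h2 : ∑ i, c i * χ (E i ∩ (A i)ᶜ) x = L := by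
        refine Finset.sum_congr rfl fun i _ => ?_
        have h3 : x ∈ (A i)ᶜ := fun h => hx (Set.mem_iUnion_of_mem i h)
        simp only [χ, Set.inter_indicator_one, Pi.mul_apply, Set.indicator_of_mem h3,
          Pi.one_apply, mul_one]
      rw [h1, h2]
      nlinarith [sq_nonneg (4 * L - 3)]
  have hi1 : ∀ i, Integrable (fun x => c i * χ (E i) x) P := fun i => (hχ _ (hEn i)).1.const_mul _
  have hi2 : ∀ i j, Integrable (fun x => c i * c j * χ (E i ∩ E j) x) P := fun i j =>
    (hχ _ (hEE i j)).1.const_mul _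
  have hi3 : ∀ i, Integrable (fun x => c i * χ (E i ∩ (A i)ᶜ) x) P := fun i =>
    (hχ _ (hEA i)).1.const_mul _
  have hI1 := integrable_finsetSum Finset.univ fun i _ => hi1 i
  have hI2 := integrable_finsetSum Finset.univ fun i _ =>
    integrable_finsetSum Finset.univ fun j _ => hi2 i j
  have hI3 := integrable_finsetSum Finset.univ fun i _ => hi3 i
  have hI4 : Integrable (fun x => -(9 / 8) + 4 * ∑ i, c i * χ (E i) x) P :=
    (integrable_const _).add (hI1.const_mul 4)
  have hint := integral_mono (hI4.sub (hI2.const_mul 2)) (hI3.add (hχ _ hU).1) hpt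
  have e1 : ∫ x, ∑ i, c i * χ (E i) x ∂P = 1 := by
    rw [integral_finsetSum _ fun i _ => hi1 i]
    simp_rw [integral_const_mul, (hχ _ (hEn _)).2, hce]
    rw [Finset.sum_const, Finset.card_univ, nsmul_eq_mul, ← hM, mul_inv_cancel₀ hM0.ne']
  have e2 : ∫ x, ∑ i, ∑ j, c i * c j * χ (E i ∩ E j) x ∂P ≤ 1 + 1 / 16 := by
    rw [integral_finsetSum _ fun i _ => integrable_finsetSum _ fun j _ => hi2 i j]
    simp_rw [integral_finsetSum _ fun j _ => hi2 _ j, integral_const_mul, (hχ _ (hEE _ _)).2]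
    -- Off the diagonal this is negative correlation; on it, c_i² P(E_i) = c_i/M ≤ 1/(16M).
    have h1 : ∀ i j, c i * c j * P.real (E i ∩ E j) ≤
        M⁻¹ * M⁻¹ + if i = j then M⁻¹ * (1 / 16) else 0 := by
      intro i j
      split_ifs with hij
      · subst hij
        rw [Set.inter_self, mul_assoc, hce, mul_comm]
        have := mul_le_mul_of_nonneg_left (hc16 i) (inv_nonneg.2 hM0.le)
        have := mul_self_nonneg M⁻¹
        linarith
      · rw [add_zero, ← hce i]
        nth_rewrite 2 [hce i]
        rw [← hce j]
        calc c i * c j * P.real (E i ∩ E j) ≤ c i * c j * (P.real (E i) * P.real (E j)) :=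
              mul_le_mul_of_nonneg_left (hcorr i j hij) (mul_nonneg (hc0 i) (hc0 j))
          _ = _ := by ring
    refine (Finset.sum_le_sum fun i _ => Finset.sum_le_sum fun j _ => h1 i j).trans (le_of_eq ?_)
    simp only [Finset.sum_add_distrib, Finset.sum_const, Finset.card_univ, nsmul_eq_mul,
      Finset.sum_ite_eq, Finset.mem_univ, if_true, ← hM]
    field_simp
  have e3 : ∫ x, ∑ i, c i * χ (E i ∩ (A i)ᶜ) x ∂P = ∑ i, c i * P.real (E i ∩ (A i)ᶜ) := by
    rw [integral_finsetSum _ fun i _ => hi3 i]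
    simp_rw [integral_const_mul, (hχ _ (hEA _)).2]
  have hL : ∫ x, (-(9 / 8) + 4 * ∑ i, c i * χ (E i) x -
      2 * ∑ i, ∑ j, c i * c j * χ (E i ∩ E j) x) ∂P = -(9 / 8) + 4 * 1 -
      2 * ∫ x, ∑ i, ∑ j, c i * c j * χ (E i ∩ E j) x ∂P := by
    rw [integral_sub hI4 (hI2.const_mul 2),
      integral_add (integrable_const _) (hI1.const_mul 4), integral_const_mul, integral_const_mul,
      e1, integral_const]
    simp
  have hR : ∫ x, (∑ i, c i * χ (E i ∩ (A i)ᶜ) x + χ (⋃ i, A i) x) ∂P =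
      ∑ i, c i * P.real (E i ∩ (A i)ᶜ) + P.real (⋃ i, A i) := by
    rw [integral_add hI3 (hχ _ hU).1, e3, (hχ _ hU).2]
  have hfin : 3 / 4 ≤ ∑ i, c i * P.real (E i ∩ (A i)ᶜ) + P.real (⋃ i, A i) := by
    rw [← hR]
    refine le_trans ?_ hint
    refine le_trans ?_ hL.ge
    linarith
  by_contra! hcon
  obtain ⟨h1, h2⟩ := hcon
  have h3 : ∑ i, c i * P.real (E i ∩ (A i)ᶜ) ≤ ∑ _i : ι, M⁻¹ * (1 / 4) := by
    refine Finset.sum_le_sum fun i _ => ?_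
    simp only [hc]
    rw [mul_inv, mul_assoc]
    exact mul_le_mul_of_nonneg_left (h2 i).le (inv_nonneg.2 hM0.le)
  rw [Finset.sum_const, Finset.card_univ, nsmul_eq_mul, ← hM, mul_inv_cancel_left₀ hM0.ne'] at h3
  linarith

/-! ### From testing errors to the minimax bound -/

/-- Markov's inequality with no measurability of `f` and only null-measurability of `S`, which is
all that hitting events provide. -/
theorem rpow_mul_measure_le_lintegral {Ω : Type*} [MeasurableSpace Ω] {μ : Measure Ω}
    {f : Ω → ℝ≥0∞} {S : Set Ω} (hS : NullMeasurableSet S μ) {a : ℝ≥0∞} {q : ℝ} (hq : 0 ≤ q)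
    (hf : ∀ x ∈ S, a ≤ f x) : a ^ q * μ S ≤ ∫⁻ x, f x ^ q ∂μ := by
  rw [← lintegral_indicator_const₀ hS]
  refine lintegral_mono fun x => ?_
  by_cases hx : x ∈ S
  · rw [Set.indicator_of_mem hx]
    exact ENNReal.rpow_le_rpow (hf x hx) hq
  · rw [Set.indicator_of_notMem hx]
    exact zero_le

/-- The points of a cap of the unit ball of height `t` around `u` are close to `u`. -/
theorem norm_sub_sq_le_of_mem_cap {d : ℕ} {u x : Euc d} (hu : ‖u‖ = 1) {t : ℝ}
    (hx : x ∈ Metric.closedBall (0 : Euc d) 1) (hxt : 1 - t ≤ inner ℝ u x) :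
    ‖u - x‖ ^ 2 ≤ 2 * t := by
  rw [mem_closedBall_zero_iff] at hx
  rw [norm_sub_sq_real, hu]
  nlinarith [norm_nonneg x]

/-- A set that misses a neighbourhood of a point `u` of `K` is far from `K`. -/
theorem le_hausdorffEDist_of_inter_ball_eq_empty {d : ℕ} {S K : Set (Euc d)} {u : Euc d}
    (hu : u ∈ K) {δ : ℝ} (h : ¬(S ∩ Metric.ball u δ).Nonempty) :
    ENNReal.ofReal δ ≤ Metric.hausdorffEDist S K := by
  rw [Metric.hausdorffEDist_comm]
  refine le_trans ?_ (Metric.infEDist_le_hausdorffEDist_of_mem hu)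
  refine Metric.le_infEDist.2 fun y hy => ?_
  rw [edist_dist]
  refine ENNReal.ofReal_le_ofReal (not_lt.1 fun hlt => h ⟨y, hy, ?_⟩)
  rwa [Metric.mem_ball, dist_comm]

/-- A set that hits a small neighbourhood of a unit vector `u` is far from a set that lies on the
other side of a hyperplane. -/
theorem le_hausdorffEDist_of_inter_ball_nonempty {d : ℕ} {S K : Set (Euc d)} {u : Euc d}
    (hu : ‖u‖ = 1) {δ : ℝ} (hK : ∀ x ∈ K, inner ℝ u x ≤ 1 - 2 * δ)
    (h : (S ∩ Metric.ball u δ).Nonempty) :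
    ENNReal.ofReal δ ≤ Metric.hausdorffEDist S K := by
  obtain ⟨y, hy, hyu⟩ := h
  refine le_trans ?_ (Metric.infEDist_le_hausdorffEDist_of_mem hy)
  refine Metric.le_infEDist.2 fun x hx => ?_
  rw [edist_dist, dist_eq_norm]
  refine ENNReal.ofReal_le_ofReal ?_
  rw [mem_ball_iff_norm] at hyu
  have h1 := real_inner_le_norm u (y - x)
  have h2 := abs_real_inner_le_norm u (y - u)
  rw [hu, one_mul, inner_sub_right] at h1 h2
  rw [real_inner_self_eq_norm_sq, hu] at h2
  have h3 := hK x hx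
  have h4 := (abs_le.1 h2).1
  linarith

/-- The lower bound for the maximal risk obtained from `k ^ m` disjoint caps. -/
theorem exists_le_maxRisk_of_caps (m : ℕ) {r : ℝ} (hr0 : 0 < r) (hr1 : r < 1) {q : ℝ}
    (hq : 0 ≤ q) :
    ∃ c : ℝ, 0 < c ∧ ∀ n k : ℕ, 1 ≤ k → ∀ τ : ℝ, τ = 1 / (4 * (m + 1) * k) →
      c * τ ^ (m + 2) < 1 → 16 ≤ (k : ℝ) ^ m * (1 - c * τ ^ (m + 2)) ^ n →
      ∀ T : (Fin n → Euc (m + 1)) → Set (Euc (m + 1)), IsSetEstimator T →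
        ENNReal.ofReal (((1 - r) * τ ^ 2 / 2) ^ q * (1 / 4)) ≤ maxRisk r q T := by
  set V := volume (Metric.closedBall (0 : Euc (m + 1)) 1) with hV
  obtain ⟨hV0, hV1⟩ := volume_closedBall_pos_and_lt_top (a := (0 : Euc (m + 1))) one_pos
  rw [← hV] at hV0 hV1
  have hVi : V⁻¹ ≠ ∞ := ENNReal.inv_ne_top.2 hV0.ne'
  have hVi0 : 0 < V⁻¹.toReal := ENNReal.toReal_pos (ENNReal.inv_ne_zero.2 hV1.ne) hVi
  refine ⟨V⁻¹.toReal * (2 * √2) ^ m, by positivity, ?_⟩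
  intro n k hk τ hτ hp1 hcard T hT
  set p := V⁻¹.toReal * (2 * √2) ^ m * τ ^ (m + 2) with hp
  have hk1 : (1 : ℝ) ≤ k := by exact_mod_cast hk
  have hr : 0 < 1 - r := by linarith
  have hden : (1 : ℝ) ≤ (m + 1) * k := by nlinarith [Nat.cast_nonneg (α := ℝ) m]
  have hτ0 : 0 < τ := by rw [hτ]; positivity
  have hτ1 : τ ≤ 1 := by
    rw [hτ]
    exact div_le_one_of_le₀ (by nlinarith) (by positivity)
  have hτ2 : τ ^ 2 ≤ 1 := pow_le_one₀ hτ0.le hτ1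
  -- Flattening by 2δ loses only a cap of height 2δ/(1 - r) = τ².
  set δ := (1 - r) * τ ^ 2 / 2 with hδ
  obtain ⟨u, hu, hsep⟩ := exists_separated_unit_vectors m hk
  obtain ⟨B, hB, hBe⟩ := exists_unitBall_mem_rollingBodies (m + 1) hr0 hr1
  have hδ1 : 2 * δ ≤ 1 - r := by rw [hδ]; nlinarith
  have hδt : 2 * δ / (1 - r) = τ ^ 2 := by rw [hδ]; field_simp
  have hflat := fun j => exists_flattened_ball hr0 hr1 (hu j) hδ1
  simp only [hδt] at hflat
  choose K hK hKu hKB using hflat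
  have := isProbabilityMeasure_cond_of_mem_rollingBodies hB
  set μ := cond volume (B : Set (Euc (m + 1))) with hμ
  set P := uniformSample n B with hP
  have hKm := fun j => (K j).isClosed.measurableSet
  have hKsub : ∀ j, (K j : Set (Euc (m + 1))) ⊆ B := fun j => by rw [hBe]; exact (hK j).2.1
  let E : (Fin m → Fin k) → Set (Fin n → Euc (m + 1)) := fun j => {X | ∀ i, X i ∈ (K j : Set _)}
  -- Missing the ball around u_j puts the estimate δ-far from the unit ball; hitting it puts the
  -- estimate δ-far from K_j.
  let A : (Fin m → Fin k) → Set (Fin n → Euc (m + 1)) := fun j =>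
    {X | (T X ∩ Metric.ball (u j) δ).Nonempty}ᶜ
  have hmeas : ∀ s : Set (Euc (m + 1)), MeasurableSet s →
      MeasurableSet {X : Fin n → Euc (m + 1) | ∀ i, X i ∈ s} := fun s hs => by
    rw [Set.ofPred_forall]
    exact MeasurableSet.iInter fun i => measurable_pi_apply i hs
  have hA : ∀ (ν : Measure (Fin n → Euc (m + 1))) [IsFiniteMeasure ν] (j), NullMeasurableSet (A j) ν :=
    fun ν _ j => (hT.nullMeasurableSet_inter_nonempty Metric.isOpen_ball.measurableSet ν).compl
  have hPreal : ∀ s : Set (Euc (m + 1)), P.real {X | ∀ i, X i ∈ s} = μ.real s ^ n := fun s => by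
    rw [measureReal_def, hP, uniformSample_setOf_forall_mem, ENNReal.toReal_pow, measureReal_def]
  have hμK : ∀ j, 1 - p ≤ μ.real (K j) := by
    intro j
    have h1 : μ (K j : Set (Euc (m + 1)))ᶜ ≤ ENNReal.ofReal p := by
      rw [hμ, cond_apply B.isClosed.measurableSet, hBe, ← hV, ← Set.sdiff_eq]
      refine (mul_le_mul' le_rfl ((measure_mono (hKB j)).trans
        (volume_cap_le (hu j) (sq_nonneg τ) hτ2))).trans (le_of_eq ?_)
      rw [hp, mul_assoc, ENNReal.ofReal_mul hVi0.le, ENNReal.ofReal_toReal hVi,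
        Real.sqrt_mul (by norm_num), Real.sqrt_sq hτ0.le]
      congr 2
      ring
    have h2 := probReal_compl_eq_one_sub (μ := μ) (hKm j)
    have h3 : μ.real (K j : Set (Euc (m + 1)))ᶜ ≤ p :=
      ENNReal.toReal_le_of_le_ofReal (by positivity) h1
    linarith
  have hp0 : 0 < 1 - p := by linarith
  have hEe : ∀ j, (1 - p) ^ n ≤ P.real (E j) := fun j => by
    rw [hPreal]
    exact pow_le_pow_left₀ hp0.le (hμK j) n
  have hcorr : ∀ i j, i ≠ j → P.real (E i ∩ E j) ≤ P.real (E i) * P.real (E j) := by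
    intro i j hij
    have h1 : E i ∩ E j = {X | ∀ l, X l ∈ (K i ∩ K j : Set (Euc (m + 1)))} := by
      ext X
      exact forall_and.symm
    rw [h1, hPreal, hPreal, hPreal, ← mul_pow]
    refine pow_le_pow_left₀ measureReal_nonneg ?_ n
    -- A point lost by both bodies would be within √2 τ of both poles, which are 4τ apart. Hence
    -- μ(K_i ∩ K_j) = μ(K_i) + μ(K_j) - 1 ≤ μ(K_i) μ(K_j).
    have h2 : (B : Set (Euc (m + 1))) ⊆ K i ∪ K j := by
      intro x hx
      by_contra hxU
      rw [Set.mem_union, not_or] at hxU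
      rw [hBe] at hx
      have h3 := norm_sub_sq_le_of_mem_cap (hu i) hx (hKB i ⟨hx, hxU.1⟩).2
      have h4 := norm_sub_sq_le_of_mem_cap (hu j) hx (hKB j ⟨hx, hxU.2⟩).2
      have h5 : ‖u i - u j‖ ≤ ‖u i - x‖ + ‖u j - x‖ := by
        rw [norm_sub_rev (u j)]
        exact norm_sub_le_norm_sub_add_norm_sub _ _ _
      have h6 := (hsep i j hij).trans h5
      have h7 : 1 / (k * (m + 1) : ℝ) = 4 * τ := by
        rw [hτ]; field_simp
      rw [h7] at h6
      nlinarith [sq_nonneg (‖u i - x‖ - ‖u j - x‖), sq_nonneg (‖u i - x‖ + ‖u j - x‖ - 4 * τ)]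
    have h3 : μ.real (K i ∪ K j : Set (Euc (m + 1))) = 1 := by
      have h4 : μ (B : Set (Euc (m + 1))) = 1 :=
        cond_apply_self hB.1.ne' B.isCompact.measure_lt_top.ne
      have h5 : μ (K i ∪ K j : Set (Euc (m + 1))) = 1 :=
        le_antisymm prob_le_one (h4.ge.trans (measure_mono h2))
      rw [measureReal_def, h5, ENNReal.toReal_one]
    have h4 := measureReal_union_add_inter (μ := μ) (s := (K i : Set (Euc (m + 1)))) (hKm j)
    have h5 : μ.real (K i : Set (Euc (m + 1))) ≤ 1 := measureReal_le_one
    have h6 : μ.real (K j : Set (Euc (m + 1))) ≤ 1 := measureReal_le_one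
    nlinarith
  have hfin : ∀ S, ∀ L ∈ rollingBodies (m + 1) r,
      NullMeasurableSet S (uniformSample n L) →
      (∀ X ∈ S, ENNReal.ofReal δ ≤ Metric.hausdorffEDist (T X) (L : Set (Euc (m + 1)))) →
      1 / 4 ≤ (uniformSample n L).real S →
      ENNReal.ofReal (δ ^ q * (1 / 4)) ≤ maxRisk r q T := by
    intro S L hL hS hdist hreal
    have := isProbabilityMeasure_cond_of_mem_rollingBodies hL
    have hδ0 : 0 ≤ δ := by positivity
    refine le_trans ?_ ((rpow_mul_measure_le_lintegral hS hq hdist).trans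
      (le_iSup₂ (f := fun L (_ : L ∈ rollingBodies (m + 1) r) => risk q T L) L hL))
    rw [ENNReal.ofReal_rpow_of_nonneg hδ0 hq, ENNReal.ofReal_mul (by positivity)]
    gcongr
    exact ENNReal.ofReal_le_of_le_toReal hreal
  have hcard' : 16 ≤ Fintype.card (Fin m → Fin k) * (1 - p) ^ n := by
    simpa using hcard
  rcases exists_error_ge_of_weakly_dependent (P := P) (E := E) (A := A)
    (fun j => hmeas _ (hKm j)) (hA P) (pow_pos hp0 n) hEe hcard' hcorr with h | ⟨j, h⟩
  · refine hfin _ B hB (NullMeasurableSet.iUnion (hA P)) (fun X hX => ?_) h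
    obtain ⟨j, hj⟩ := Set.mem_iUnion.1 hX
    exact le_hausdorffEDist_of_inter_ball_eq_empty (by rw [hBe]; simp [hu j]) hj
  · have := isProbabilityMeasure_cond_of_mem_rollingBodies (hK j)
    refine hfin (A j)ᶜ (K j) (hK j) (hA _ j).compl (fun X hX => ?_) ?_
    · exact le_hausdorffEDist_of_inter_ball_nonempty (hu j) (hKu j) (not_not.1 hX)
    · rwa [uniformSample_eq_cond (hKsub j) (hK j).1.ne', measureReal_def,
        cond_apply (hmeas _ (hKm j)), ENNReal.toReal_mul, ENNReal.toReal_inv]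

/-- The minimax lower bound for two or more observations. -/
theorem exists_le_maxRisk {m : ℕ} (hm : 1 ≤ m) {r : ℝ} (hr0 : 0 < r) (hr1 : r < 1) {q : ℝ}
    (hq : 0 ≤ q) :
    ∃ c : ℝ, 0 < c ∧ ∀ n : ℕ, 2 ≤ n → ∀ T : (Fin n → Euc (m + 1)) → Set (Euc (m + 1)),
      IsSetEstimator T → ENNReal.ofReal (c * rate (m + 1) q n) ≤ maxRisk r q T := by
  obtain ⟨c, hc, hmain⟩ := exists_le_maxRisk_of_caps m hr0 hr1 hq
  have hr : 0 < 1 - r := by linarith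
  -- The term 12c gives p ≤ ln n/(12n), hence (1 - p)^n ≥ n^(-1/6); the term 32 gives at least 16
  -- n^(1/6) caps.
  set A : ℝ := 32 + 12 * c with hA
  have hA1 : 1 ≤ A := by linarith
  refine ⟨((1 - r) * (1 / (8 * (m + 1) * A)) ^ 2 / 2) ^ q * (1 / 4), by positivity,
    fun n hn T hT => ?_⟩
  have hn2 : (2 : ℝ) ≤ n := by exact_mod_cast hn
  have hn0 : (0 : ℝ) < n := by linarith
  have hlog : 0 ≤ Real.log n := Real.log_nonneg (by linarith)
  rw [rate_eq]
  have hρ0 := rateBase_pos m hn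
  have hρ1 := rateBase_le_one m hn
  have hρp := rateBase_pow m n
  set ρ := rateBase m n with hρ
  set k := ⌈A / ρ⌉₊ with hk
  have hkle : A / ρ ≤ k := Nat.le_ceil _
  have hAρ : 1 ≤ A / ρ := by rw [le_div_iff₀ hρ0]; linarith
  have hkub : (k : ℝ) ≤ 2 * (A / ρ) := by
    have : (k : ℝ) < A / ρ + 1 := Nat.ceil_lt_add_one (by positivity)
    linarith
  have hk1 : (1 : ℝ) ≤ k := hAρ.trans hkle
  have hk1' : 1 ≤ k := by exact_mod_cast hk1
  set τ : ℝ := 1 / (4 * (m + 1) * k) with hτ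
  have hτ0 : 0 < τ := by positivity
  have hτle : τ ≤ ρ / A := by
    rw [hτ, div_le_div_iff₀ (by positivity) (by positivity)]
    rw [div_le_iff₀ hρ0] at hkle
    have : (k : ℝ) ≤ 4 * (m + 1) * k := by nlinarith [Nat.cast_nonneg (α := ℝ) m]
    nlinarith
  have hτge : 1 / (8 * (m + 1) * A) * ρ ≤ τ := by
    rw [hτ, div_mul_eq_mul_div, one_mul, div_le_div_iff₀ (by positivity) (by positivity)]
    rw [mul_div_assoc', le_div_iff₀ hρ0] at hkub
    have h := mul_le_mul_of_nonneg_left hkub (by positivity : (0 : ℝ) ≤ 4 * (m + 1))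
    linarith
  set p := c * τ ^ (m + 2) with hp
  have hp0 : 0 ≤ p := by positivity
  have hple : p ≤ c / A * (Real.log n / n) := by
    calc p ≤ c * (ρ / A) ^ (m + 2) := by rw [hp]; gcongr
      _ = c * (Real.log n / n) / A ^ (m + 2) := by rw [div_pow, hρp]; ring
      _ ≤ c * (Real.log n / n) / A := by
          gcongr
          exact le_self_pow₀ hA1 (by omega)
      _ = c / A * (Real.log n / n) := by ring
  have hcA : c / A ≤ 1 / 12 := by
    rw [div_le_div_iff₀ (by positivity) (by norm_num)]
    linarith
  have hlogn : Real.log n / n ≤ 1 := by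
    rw [div_le_one hn0]
    linarith [Real.log_le_sub_one_of_pos hn0]
  have hp2 : p ≤ 1 / 2 := by
    have : 0 ≤ Real.log n / n := by positivity
    nlinarith
  have hexp : (n : ℝ) ^ (-(1 / 6 : ℝ)) ≤ (1 - p) ^ n := by
    have h1 : Real.exp (-(2 * p)) ≤ 1 - p := by
      have h2 := Real.add_one_le_exp (2 * p)
      rw [Real.exp_neg]
      refine inv_le_of_inv_le₀ (by linarith) (le_trans ?_ h2)
      rw [inv_le_iff_one_le_mul₀ (by linarith)]
      nlinarith
    refine le_trans ?_ (pow_le_pow_left₀ (Real.exp_pos _).le h1 n)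
    rw [← Real.exp_nat_mul, Real.rpow_def_of_pos hn0]
    refine Real.exp_le_exp.2 ?_
    have h3 : n * p ≤ 1 / 12 * Real.log n := by
      calc n * p ≤ n * (c / A * (Real.log n / n)) := by gcongr
        _ = c / A * Real.log n := by field_simp
        _ ≤ 1 / 12 * Real.log n := by gcongr
    linarith
  have hkm : 16 * (n : ℝ) ^ (1 / 6 : ℝ) ≤ (k : ℝ) ^ m := by
    -- Cubing turns n^(1/6) into √n, and m + 2 ≤ 3m lets the cubed number of caps dominate
    -- ρ^(-(m+2)) = n/ln n; this is where m ≥ 1, that is d ≥ 2, enters.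
    refine le_of_pow_le_pow_left₀ three_ne_zero (by positivity) ?_
    have h1 : ((n : ℝ) ^ (1 / 6 : ℝ)) ^ 3 = √n := by
      rw [Real.sqrt_eq_rpow, ← Real.rpow_natCast, ← Real.rpow_mul hn0.le]
      norm_num
    have h2 : Real.log n ≤ 2 * √n := by
      have h3 := Real.log_le_sub_one_of_pos (Real.sqrt_pos.2 hn0)
      rw [Real.log_sqrt hn0.le] at h3
      linarith
    have hs : √n * √n = n := Real.mul_self_sqrt hn0.le
    have hs0 : 0 < √(n : ℝ) := Real.sqrt_pos.2 hn0
    have hlog0 : 0 < Real.log n := Real.log_pos (by linarith)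
    calc (16 * (n : ℝ) ^ (1 / 6 : ℝ)) ^ 3 = 32 ^ 3 * (√n / 8) := by rw [mul_pow, h1]; ring
      _ ≤ A ^ 3 * (n / Real.log n) := by
          have h3 : √(n : ℝ) / 8 ≤ n / Real.log n := by
            rw [div_le_div_iff₀ (by norm_num) hlog0]
            nlinarith
          have h4 : 32 ≤ A := by linarith
          gcongr
      _ = A ^ 3 * (1 / ρ) ^ (m + 2) := by rw [one_div, inv_pow, hρp, inv_div]
      _ ≤ A ^ 3 * (1 / ρ) ^ (m * 3) := by
          gcongr
          · exact (one_le_div hρ0).2 hρ1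
          · omega
      _ ≤ (A ^ m) ^ 3 * (1 / ρ) ^ (m * 3) := by
          gcongr
          exact le_self_pow₀ hA1 (by omega)
      _ = ((A / ρ) ^ m) ^ 3 := by
          rw [pow_mul, ← mul_pow, ← mul_pow, mul_one_div]
      _ ≤ ((k : ℝ) ^ m) ^ 3 := by gcongr
  have h16 : 16 ≤ (k : ℝ) ^ m * (1 - p) ^ n := by
    calc (16 : ℝ) = 16 * (n : ℝ) ^ (1 / 6 : ℝ) * (n : ℝ) ^ (-(1 / 6 : ℝ)) := by
          rw [mul_assoc, ← Real.rpow_add hn0]; simp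
      _ ≤ (k : ℝ) ^ m * (1 - p) ^ n := by gcongr
  refine le_trans (ENNReal.ofReal_le_ofReal ?_)
    (hmain n k hk1' τ hτ (by linarith) h16 T hT)
  rw [mul_right_comm, ← Real.mul_rpow (by positivity) (by positivity)]
  gcongr
  calc (1 - r) * (1 / (8 * (m + 1) * A)) ^ 2 / 2 * ρ ^ 2
      = (1 - r) * (1 / (8 * (m + 1) * A) * ρ) ^ 2 / 2 := by ring
    _ ≤ (1 - r) * τ ^ 2 / 2 := by gcongr

/-- Minimax lower bound over all set estimators (first part, with a constant that depends only on
`d`, `r`, `q`), and rate-optimality of the convex hull of the observations (second part: it is a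
set estimator whose maximal risk is at most of the same order). -/
theorem mainTheorem2 (d : ℕ) (hd : 2 ≤ d) (r : ℝ) (hr0 : 0 < r) (hr1 : r < 1)
    (q : ℝ) (hq : 1 ≤ q) :
    (∃ c : ℝ, 0 < c ∧ ∀ n : ℕ, 1 ≤ n →
      ∀ T : (Fin n → Euc d) → Set (Euc d), IsSetEstimator T →
        ENNReal.ofReal (c * rate d q n) ≤ maxRisk r q T) ∧
    ((∀ n : ℕ, 1 ≤ n → IsSetEstimator (randomPolytope d n)) ∧
      ∃ C : ℝ, 0 < C ∧ ∀ n : ℕ, 2 ≤ n →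
        maxRisk r q (randomPolytope d n) ≤ ENNReal.ofReal (C * rate d q n)) := by
  obtain ⟨m, rfl⟩ : ∃ m, d = m + 1 := ⟨d - 1, by omega⟩
  refine ⟨?_, fun n _ => isSetEstimator_randomPolytope _ n,
    exists_maxRisk_randomPolytope_le m hr0 hr1 hq⟩
  obtain ⟨c, hc, h⟩ := exists_le_maxRisk (m := m) (by omega) hr0 hr1 (by linarith : 0 ≤ q)
  refine ⟨c, hc, fun n hn T hT => ?_⟩
  -- At n = 1 the rate vanishes, since ln 1 = 0 and the exponent is positive.
  rcases hn.eq_or_lt with rfl | hn2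
  · have h0 : rate (m + 1) q 1 = 0 := by
      rw [rate, Nat.cast_one, Real.log_one, zero_div, Real.zero_rpow (by positivity)]
    simp [h0]
  · exact h n hn2 T hT
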